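/- Let $x:I\to\mathbb{R}^3$ be a $C^\infty$ curve parametrised by arc length $s$ on an open interval $I$, with curvature $\kappa=|x''|>0$ and torsion $\tau$ given by the Frenet--Serret equations $t'=\kappa n$, $n'=-\kappa t+\tau b$, $b'=-\tau n$ ($t=x'$, $b=t\times n$). A prime denotes $d/ds$. Assume that $\nu=\sqrt{(\kappa')^2+\kappa^2\tau^2}>0$ on $I$. The conformal length is given by $d\omega=\sqrt{\nu}\,ds$, and the conformal curvature and the conformal torsion are $$Q=\frac{4(\nu''-\kappa^2\nu)\nu-5(\nu')^2}{8\nu^3},\qquad T=\frac{2(\kappa')^2\tau+\kappa^2\tau^3+\kappa\kappa'\tau'-\kappa\kappa''\tau}{\nu^{5/2}} .$$ Fix $s_0\in I$. For $w$ near $0$ let $\sigma(w)\in I$ be the parameter at conformal length $w$ from $s_0$, that is, $\int_{s_0}^{\sigma(w)}\sqrt{\nu}\,ds=w$; such parameters $\sigma(w)$ exist for all $w$ near $0$, and $\sigma(0)=s_0$. For $\omega\neq0$ near $0$ consider the five points $$x_1=x(\sigma(-2\omega)),\quad x_2=x(\sigma(-\omega)),\quad x_3=x(\sigma(0))=x(s_0),\quad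 x_4=x(\sigma(\omega)),\quad x_5=x(\sigma(2\omega)) .$$ For all sufficiently small $\omega\neq0$ each of the triples $(x_1,x_2,x_3)$, $(x_2,x_3,x_4)$, $(x_3,x_4,x_5)$ is non-collinear and so determines a circle. Let $\alpha\in[0,\pi]$ be the cusp angle at $x_3$ between the arc from $x_2$ to $x_3$ of the circle through $x_1,x_2,x_3$ and the arc from $x_3$ to $x_4$ of the circle through $x_2,x_3,x_4$, that is, the angle at $x_3$ between the tangent vector of the first circle, run through in the direction $x_1\to x_2\to x_3$, and the tangent vector of the second circle, run through in the direction $x_2\to x_3\to x_4$. Then, as $\omega\to0$, $$\cos\alpha=1-\tfrac18\,\omega^4+P\,\omega^6+O(\omega^7),$$ where, with all functions evaluated at $s_0$, $$\begin{aligned}P=\frac{1}{192(\kappa^2\tau^2+\kappa'^2)^{5/2}}\Big(&2\kappa\tau\kappa'^2(20\kappa'\tau'-19\tau\kappa'')+2\kappa^3\tau^3(5\kappa'\tau'-4\tau\kappa'')+\kappa'^2(28\tau^2\kappa'^2-5\kappa''^2+4\kappa'\kappa''')\\&+\kappa^2\big(19\tau^4\kappa'^2-4\kappa'^4+10\kappa'^2\tau'^2+2\tau\kappa'(2\kappa'\tau''-15\tau'\kappa'')+2\tau^2(5\kappa''^2+2\kappa'\kappa''')\big)\\&+\kappa^4\tau^2(6\tau^4-8\kappa'^2-5\tau'^2+4\tau\tau'')-4\kappa^6\tau^4\Big).\end{aligned}$$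 Moreover, at $s_0$, $$P=\tfrac1{24}\Big(Q+\tfrac34T^2\Big).$$ -/

import Mathlib

open scoped ContDiff Topology
open Asymptotics

noncomputable section

namespace ConformalCurve

/-- Euclidean three-space. -/
abbrev E3 : Type := EuclideanSpace ℝ (Fin 3)

/-- The cross product on Euclidean three-space. -/
def cross (u v : E3) : E3 := WithLp.toLp 2 (crossProduct u.ofLp v.ofLp)

/-! ### Frenet–Serret data of a curve parametrised by arc length -/

/-- The unit tangent `t = x'`. -/
def tangent (x : ℝ → E3) : ℝ → E3 := deriv x

/-- The curvature `κ = |t'|`. -/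
def curvature (x : ℝ → E3) (s : ℝ) : ℝ := ‖deriv (tangent x) s‖

/-- The principal normal `n`, so that `t' = κ n`. -/
def normal (x : ℝ → E3) (s : ℝ) : E3 := (curvature x s)⁻¹ • deriv (tangent x) s

/-- The binormal `b = t × n`. -/
def binormal (x : ℝ → E3) (s : ℝ) : E3 := cross (tangent x s) (normal x s)

/-- The torsion `τ`, the `b`-component of `n'` (as in `n' = -κ t + τ b`). -/
def torsion (x : ℝ → E3) (s : ℝ) : ℝ := inner ℝ (deriv (normal x) s) (binormal x s)

/-! ### Conformal quantities, as expressions in the functions `κ`, `τ` of arc length -/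

/-- `ν = √((κ')² + κ² τ²)`. -/
def nu (κ τ : ℝ → ℝ) (s : ℝ) : ℝ := √((deriv κ s) ^ 2 + (κ s) ^ 2 * (τ s) ^ 2)

/-- The (signed) conformal length of the piece of the curve from `s₀` to `s`: `dω = √ν ds`. -/
def conformalLength (κ τ : ℝ → ℝ) (s₀ s : ℝ) : ℝ := ∫ u in s₀..s, √(nu κ τ u)

/-- The conformal curvature `Q`. -/
def conformalCurvature (κ τ : ℝ → ℝ) (s : ℝ) : ℝ :=
  let ν := nu κ τ
  (4 * (iteratedDeriv 2 ν s - (κ s) ^ 2 * ν s) * ν s - 5 * (deriv ν s) ^ 2) / (8 * (ν s) ^ 3)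

/-- The conformal torsion `T`. -/
def conformalTorsion (κ τ : ℝ → ℝ) (s : ℝ) : ℝ :=
  (2 * (deriv κ s) ^ 2 * τ s + (κ s) ^ 2 * (τ s) ^ 3 + κ s * deriv κ s * deriv τ s
    - κ s * iteratedDeriv 2 κ s * τ s) / (nu κ τ s) ^ (5 / 2 : ℝ)

/-- The explicit expression `P` in terms of `k = κ`, `k₁ = κ'`, `k₂ = κ''`, `k₃ = κ'''`,
`t = τ`, `t₁ = τ'`, `t₂ = τ''`. -/
def sixthOrderCoeff (κ τ : ℝ → ℝ) (s : ℝ) : ℝ :=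
  let k := κ s
  let k₁ := deriv κ s
  let k₂ := iteratedDeriv 2 κ s
  let k₃ := iteratedDeriv 3 κ s
  let t := τ s
  let t₁ := deriv τ s
  let t₂ := iteratedDeriv 2 τ s
  (2 * k * t * k₁ ^ 2 * (20 * k₁ * t₁ - 19 * t * k₂)
    + 2 * k ^ 3 * t ^ 3 * (5 * k₁ * t₁ - 4 * t * k₂)
    + k₁ ^ 2 * (28 * t ^ 2 * k₁ ^ 2 - 5 * k₂ ^ 2 + 4 * k₁ * k₃)
    + k ^ 2 * (19 * t ^ 4 * k₁ ^ 2 - 4 * k₁ ^ 4 + 10 * k₁ ^ 2 * t₁ ^ 2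
        + 2 * t * k₁ * (2 * k₁ * t₂ - 15 * t₁ * k₂)
        + 2 * t ^ 2 * (5 * k₂ ^ 2 + 2 * k₁ * k₃))
    + k ^ 4 * t ^ 2 * (6 * t ^ 4 - 8 * k₁ ^ 2 - 5 * t₁ ^ 2 + 4 * t * t₂)
    - 4 * k ^ 6 * t ^ 4) / (192 * (k ^ 2 * t ^ 2 + k₁ ^ 2) ^ (5 / 2 : ℝ))

/-! ### Circumcircles and cusp angles -/

open Classical in
/-- The unit tangent vector at `z` of the circle through the three non-collinear points
`p`, `q`, `r`, where `z` is a point of this circle and the circle is run through in the direction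
`p → q → r`. With `c` the centre of the circle, this is the normalisation of
`N × (z - c)` for `N = (q - p) × (r - p)`, since seen from the tip of `N` the circle is run
through counterclockwise. (It is `0` when `p`, `q`, `r` are collinear.) -/
def circleTangent (p q r z : E3) : E3 :=
  if h : AffineIndependent ℝ ![p, q, r] then
    let c : E3 := (⟨![p, q, r], h⟩ : Affine.Simplex ℝ E3 2).circumcenter
    let v : E3 := cross (cross (q - p) (r - p)) (z - c)
    ‖v‖⁻¹ • v
  else 0

/-- The cusp angle at `x₃` between the arc from `x₂` to `x₃` of the circle through
`x₁, x₂, x₃` and the arc from `x₃` to `x₄` of the circle through `x₂, x₃, x₄`: the angle between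
the tangents at `x₃` in the direction of running through the points in order. -/
def cuspAngle (x₁ x₂ x₃ x₄ : E3) : ℝ :=
  InnerProductGeometry.angle (circleTangent x₁ x₂ x₃ x₃) (circleTangent x₂ x₃ x₄ x₃)

/-- `σ` is (near `ω = 0`) the arc length parameter on the curve as a function of the conformal
length `ω` counted from `s₀`, i.e. the local inverse of `s ↦ conformalLength s₀ s` on `I`. -/
def IsConformalLengthInverse (κ τ : ℝ → ℝ) (I : Set ℝ) (s₀ : ℝ) (σ : ℝ → ℝ) : Prop :=
  ∀ᶠ w in 𝓝 (0 : ℝ), σ w ∈ I ∧ conformalLength κ τ s₀ (σ w) = w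

end ConformalCurve

end

open ConformalCurve

/-! The cusp angle is a conformal invariant, so the expansion can be computed on a suitably scaled
lift of the curve to the light cone of Minkowski space, where only the conformal invariants survive.

By `cos_cuspAngle`, cos α = (X + Y - Z) / (2√(XY)), where X, Y, Z are the products of squared
distances over the three pairings of the four points. Each point occurs exactly once in each
product, so replacing |p - r|² by λ(p) λ(r) |p - r|² changes nothing. Under p ↦ (p, 1, |p|²/2) a
squared distance becomes -2 times a Lorentz product; the weight λ = √ν then gives the curve y = √ν
(x, 1, |x|²/2), parametrised by conformal length.

With derivatives taken in conformal length, ⟨y, y⟩ = 0, ⟨y', y'⟩ = 1, ⟨y'', y''⟩ = q = -2Q and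
⟨y''', y'''⟩ = 1 + q² (`isGramChain`). Differentiating these relations determines every product of
derivatives of total order at most 8 from q, its derivatives and the squared length of the fourth
derivative (the lemmas `b01` to `b08`). That last number carries T² (`conformalGram_four_four`).
Taylor's formula then expands all chords (`hasExpansion_chord`), and in the quotient the derivatives
of q cancel up to order 6 (`isBigO_cos`).

The explicit P is matched with Q and T algebraically, by eliminating the logarithmic derivative θ of
√ν through the derivatives of ν² = κ'² + κ²τ² (`sixthOrderCoeff_eq`). Non-collinearity of the
triples comes from the limits of divided differences. -/

namespace ConformalCurve

/-! ### Asymptotic expansions at 0: algebra and Taylor's formula -/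

section Expansion

variable {E F G : Type*} [NormedAddCommGroup E] [NormedSpace ℝ E]
  [NormedAddCommGroup F] [NormedSpace ℝ F] [NormedAddCommGroup G] [NormedSpace ℝ G]

/-- Along the filter `l` at `0`, the function `f` agrees with `∑_{k < n} w ^ k • a k` up to
`O(w ^ n)`. -/
def HasExpansion (l : Filter ℝ) (n : ℕ) (f : ℝ → E) (a : ℕ → E) : Prop :=
  (fun w => f w - ∑ k ∈ Finset.range n, w ^ k • a k) =O[l] (fun w => w ^ n)

namespace HasExpansion

variable {l : Filter ℝ} {n : ℕ} {f g : ℝ → E} {a b : ℕ → E}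

theorem isBigO (hf : HasExpansion l n f a) :
    (fun w => f w - ∑ k ∈ Finset.range n, w ^ k • a k) =O[l] (fun w => w ^ n) :=
  hf

theorem add (hf : HasExpansion l n f a) (hg : HasExpansion l n g b) :
    HasExpansion l n (fun w => f w + g w) (fun k => a k + b k) := by
  refine (IsBigO.add hf hg).congr_left fun w => ?_
  simp only [smul_add, Finset.sum_add_distrib]
  abel

theorem sub (hf : HasExpansion l n f a) (hg : HasExpansion l n g b) :
    HasExpansion l n (fun w => f w - g w) (fun k => a k - b k) := by
  refine (IsBigO.sub hf hg).congr_left fun w => ?_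
  simp only [smul_sub, Finset.sum_sub_distrib]
  abel

theorem const_smul (c : ℝ) (hf : HasExpansion l n f a) :
    HasExpansion l n (fun w => c • f w) (fun k => c • a k) := by
  refine (IsBigO.const_smul_left hf c).congr_left fun w => ?_
  simp only [Pi.smul_apply, smul_sub, Finset.smul_sum]
  simp only [smul_comm c]

theorem mono {l' : Filter ℝ} (hf : HasExpansion l n f a) (h : l' ≤ l) :
    HasExpansion l' n f a :=
  IsBigO.mono hf h

theorem congr (hf : HasExpansion l n f a) (h : ∀ k < n, a k = b k) : HasExpansion l n f b := by
  refine hf.isBigO.congr_left fun w => ?_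
  rw [Finset.sum_congr rfl fun k hk => by rw [h k (Finset.mem_range.1 hk)]]

/-- The full neighbourhood filter, unlike the punctured one, allows c = 0, which is needed for
chords ending at the base point. -/
theorem comp_mul (c : ℝ) (hf : HasExpansion (𝓝 0) n f a) :
    HasExpansion (𝓝 0) n (fun w => f (c * w)) (fun k => c ^ k • a k) := by
  have ht : Filter.Tendsto (fun w : ℝ => c * w) (𝓝 0) (𝓝 0) := by
    simpa using (continuous_const_mul c).tendsto (0 : ℝ)
  have h := hf.isBigO.comp_tendsto ht
  have h2 : (fun w : ℝ => (c * w) ^ n) =O[𝓝 0] (fun w : ℝ => w ^ n) := by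
    simp only [mul_pow]
    exact isBigO_const_mul_self _ _ _
  refine (h.trans h2).congr_left fun w => ?_
  simp only [Function.comp, mul_pow, smul_smul, mul_comm]

theorem polynomial_isBigO_one (hl : l ≤ 𝓝 0) (n : ℕ) (a : ℕ → E) :
    (fun w : ℝ => ∑ k ∈ Finset.range n, w ^ k • a k) =O[l] (fun _ => (1 : ℝ)) := by
  have hc : Continuous (fun w : ℝ => ∑ k ∈ Finset.range n, w ^ k • a k) := by fun_prop
  exact ((hc.tendsto 0).isBigO_one ℝ).mono hl

theorem pow_isBigO_one (hl : l ≤ 𝓝 0) (n : ℕ) :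
    (fun w : ℝ => w ^ n) =O[l] (fun _ => (1 : ℝ)) :=
  (((continuous_pow n).tendsto (0 : ℝ)).isBigO_one ℝ).mono hl

theorem pow_isBigO_pow (hl : l ≤ 𝓝 0) {m n : ℕ} (h : n ≤ m) :
    (fun w : ℝ => w ^ m) =O[l] (fun w => w ^ n) := by
  obtain ⟨d, rfl⟩ := Nat.exists_eq_add_of_le h
  simpa [pow_add] using (isBigO_refl (fun w : ℝ => w ^ n) l).mul (pow_isBigO_one hl d)

theorem isBigO_one (hl : l ≤ 𝓝 0) (hf : HasExpansion l n f a) :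
    f =O[l] (fun _ => (1 : ℝ)) := by
  have h := (IsBigO.trans hf (pow_isBigO_one hl n)).add (polynomial_isBigO_one hl n a)
  simpa using h

/-- The Cauchy product of two expansions under a continuous bilinear map. -/
theorem bilin (hl : l ≤ 𝓝 0) (B : E →L[ℝ] F →L[ℝ] G) {g : ℝ → F} {b : ℕ → F}
    (hf : HasExpansion l n f a) (hg : HasExpansion l n g b) :
    HasExpansion l n (fun w => B (f w) (g w))
      (fun m => ∑ k ∈ Finset.range (m + 1), B (a k) (b (m - k))) := by
  set p := fun w : ℝ => ∑ k ∈ Finset.range n, w ^ k • a k with hp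
  set r := fun w : ℝ => ∑ k ∈ Finset.range n, w ^ k • b k with hr
  have hB : ∀ (u : ℝ → E) (v : ℝ → F) (α β : ℝ → ℝ), u =O[l] α → v =O[l] β →
      (fun w => B (u w) (v w)) =O[l] (fun w => α w * β w) := by
    intro u v α β hu hv
    have h1 : (fun w => B (u w) (v w)) =O[l] (fun w => ‖u w‖ * ‖v w‖) :=
      IsBigO.of_bound ‖B‖ (Filter.Eventually.of_forall fun w => by
        simpa [mul_assoc] using B.le_opNorm₂ (u w) (v w))
    exact h1.trans (hu.norm_left.mul hv.norm_left)
  -- With p and r the truncations, B(f, g) - B(p, r) = B(f - p, g) + B(p, g - r); `h3` bounds the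
  -- terms of B(p, r) of degree at least n.
  have h1 : (fun w => B (f w - p w) (g w)) =O[l] (fun w => w ^ n) := by
    simpa only [mul_one] using hB _ _ _ _ hf (hg.isBigO_one hl)
  have h2 : (fun w => B (p w) (g w - r w)) =O[l] (fun w => w ^ n) := by
    simpa only [one_mul] using hB _ _ _ _ (polynomial_isBigO_one hl n a) hg
  have h3 : (fun w : ℝ => ∑ k ∈ Finset.range n, ∑ j ∈ Finset.Ico (n - k) n,
      w ^ (k + j) • B (a k) (b j)) =O[l] (fun w => w ^ n) := by
    refine IsBigO.fun_sum fun k hk => IsBigO.fun_sum fun j hj => ?_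
    rw [Finset.mem_Ico] at hj
    have : (fun w : ℝ => w ^ (k + j)) =O[l] (fun w => w ^ n) := pow_isBigO_pow hl (by omega)
    have h := this.smul (isBigO_refl (fun _ : ℝ => B (a k) (b j)) l)
    refine h.trans ?_
    simpa using (isBigO_refl (fun w : ℝ => w ^ n) l).smul
      (isBigO_const_const (B (a k) (b j)) (one_ne_zero (α := ℝ)) l)
  refine ((h1.add h2).add h3).congr_left fun w => ?_
  have h4 : B (p w) (r w) = ∑ k ∈ Finset.range n, ∑ j ∈ Finset.range n,
      w ^ (k + j) • B (a k) (b j) := by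
    simp only [hp, hr, map_sum, map_smul, sum_apply, smul_apply, Finset.smul_sum, smul_smul,
      ← pow_add]
    rw [Finset.sum_comm]
    refine Finset.sum_congr rfl fun k _ => Finset.sum_congr rfl fun j _ => ?_
    rw [add_comm]
  have h5 : ∑ m ∈ Finset.range n, w ^ m • ∑ k ∈ Finset.range (m + 1), B (a k) (b (m - k))
      = ∑ k ∈ Finset.range n, ∑ j ∈ Finset.range (n - k), w ^ (k + j) • B (a k) (b j) := by
    rw [← Finset.sum_range_diag_flip n (fun k j => w ^ (k + j) • B (a k) (b j))]
    refine Finset.sum_congr rfl fun m _ => ?_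
    rw [Finset.smul_sum]
    refine Finset.sum_congr rfl fun k hk => ?_
    rw [Nat.add_sub_cancel' (Nat.lt_succ_iff.1 (Finset.mem_range.1 hk))]
  have h6 : B (p w) (r w) = (∑ k ∈ Finset.range n, ∑ j ∈ Finset.range (n - k),
      w ^ (k + j) • B (a k) (b j)) + ∑ k ∈ Finset.range n, ∑ j ∈ Finset.Ico (n - k) n,
      w ^ (k + j) • B (a k) (b j) := by
    rw [h4, ← Finset.sum_add_distrib]
    refine Finset.sum_congr rfl fun k _ => ?_
    rw [Finset.sum_range_add_sum_Ico _ (Nat.sub_le n k)]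
  rw [h5]
  simp only [map_sub, sub_apply]
  rw [h6]
  abel

theorem mul (hl : l ≤ 𝓝 0) {f g : ℝ → ℝ} {a b : ℕ → ℝ}
    (hf : HasExpansion l n f a) (hg : HasExpansion l n g b) :
    HasExpansion l n (fun w => f w * g w)
      (fun m => ∑ k ∈ Finset.range (m + 1), a k * b (m - k)) :=
  hf.bilin hl (ContinuousLinearMap.mul ℝ ℝ) hg

/-- Division by `w ^ m` of an expansion whose first `m` coefficients vanish. -/
theorem inv_pow_smul {m n : ℕ} (hf : HasExpansion (𝓝 0) (m + n) f a)
    (ha : ∀ k < m, a k = 0) :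
    HasExpansion (𝓝[≠] 0) n (fun w => (w ^ m)⁻¹ • f w) (fun k => a (m + k)) := by
  have h := (isBigO_refl (fun w : ℝ => (w ^ m)⁻¹) (𝓝[≠] 0)).smul
    (hf.mono (l' := 𝓝[≠] (0 : ℝ)) nhdsWithin_le_nhds).isBigO
  refine h.congr' ?_ ?_
  · filter_upwards [self_mem_nhdsWithin] with w hw
    have hw0 : w ≠ 0 := hw
    rw [Finset.sum_range_add, Finset.sum_eq_zero (s := Finset.range m) fun k hk => by
      rw [ha k (Finset.mem_range.1 hk), smul_zero], zero_add, smul_sub, Finset.smul_sum]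
    congr 1
    refine Finset.sum_congr rfl fun k _ => ?_
    rw [smul_smul, pow_add, inv_mul_cancel_left₀ (pow_ne_zero m hw0)]
  · filter_upwards [self_mem_nhdsWithin] with w hw
    have hw0 : w ≠ 0 := hw
    rw [smul_eq_mul, pow_add, inv_mul_cancel_left₀ (pow_ne_zero m hw0)]

theorem tendsto (hl : l ≤ 𝓝 0) (hf : HasExpansion l (n + 1) f a) :
    Filter.Tendsto f l (𝓝 (a 0)) := by
  have hp : Filter.Tendsto (fun w : ℝ => ∑ k ∈ Finset.range (n + 1), w ^ k • a k) l (𝓝 (a 0)) := by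
    have hc : Continuous (fun w : ℝ => ∑ k ∈ Finset.range (n + 1), w ^ k • a k) := by fun_prop
    have := hc.tendsto 0
    rw [Finset.sum_range_succ'] at this
    simpa using this.mono_left hl
  have hr := hf.isBigO.trans_tendsto
    (((continuous_pow (n + 1)).tendsto' (0 : ℝ) 0 (by simp)).mono_left hl)
  simpa using hr.add hp

end HasExpansion

/-- Taylor's formula for a chain of successive derivatives near `0`. -/
theorem hasExpansion_of_hasDerivAt (g : ℕ → ℝ → E)
    (hg : ∀ k, ∀ᶠ w in 𝓝 (0 : ℝ), HasDerivAt (g k) (g (k + 1) w) w) (n : ℕ) :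
    HasExpansion (𝓝 0) n (g 0) (fun k => ((k.factorial : ℝ)⁻¹) • g k 0) := by
  induction n generalizing g with
  | zero =>
    have : ContinuousAt (g 0) 0 := (hg 0).self_of_nhds.continuousAt
    simpa [HasExpansion] using this.tendsto.isBigO_one ℝ
  | succ n ih =>
    -- The induction hypothesis, used for the chain shifted by one, expands the derivative; the mean
    -- value inequality on the segment from 0 to w then gains one order.
    have h1 := ih (fun k => g (k + 1)) (fun k => hg (k + 1))
    obtain ⟨C, hCnn, hC⟩ := h1.isBigO.exists_nonneg
    have hev := Filter.Eventually.and hC.bound (hg 0)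
    obtain ⟨ε, hε, hball⟩ := Metric.eventually_nhds_iff_ball.1 hev
    set p : ℝ → E := fun w => ∑ k ∈ Finset.range (n + 1), w ^ k • ((k.factorial : ℝ)⁻¹) • g k 0
      with hp
    have hpd : ∀ w, HasDerivAt p
        (∑ k ∈ Finset.range n, w ^ k • ((k.factorial : ℝ)⁻¹) • g (k + 1) 0) w := by
      intro w
      have hh : HasDerivAt p (∑ k ∈ Finset.range (n + 1),
          ((k : ℝ) * w ^ (k - 1)) • ((k.factorial : ℝ)⁻¹) • g k 0) w := by
        refine HasDerivAt.fun_sum fun k _ => ?_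
        exact (hasDerivAt_pow k w).smul_const _
      convert hh using 1
      rw [Finset.sum_range_succ']
      simp only [Nat.cast_zero, zero_mul, zero_smul, add_zero, Nat.add_sub_cancel]
      refine Finset.sum_congr rfl fun k _ => ?_
      rw [smul_smul, smul_smul, Nat.factorial_succ]
      congr 1
      push_cast
      have : (k.factorial : ℝ) ≠ 0 := by positivity
      have : (k : ℝ) + 1 ≠ 0 := by positivity
      field_simp
    refine IsBigO.of_bound C ?_
    filter_upwards [Metric.ball_mem_nhds (0 : ℝ) hε] with w hw
    have hw' : |w| < ε := by simpa using hw
    have hC0 : ∀ u ∈ Set.uIcc 0 w, |u| ≤ |w| := by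
      intro u hu
      rcases le_total 0 w with h | h
      · rw [Set.uIcc_of_le h] at hu
        rw [abs_of_nonneg hu.1, abs_of_nonneg h]; exact hu.2
      · rw [Set.uIcc_of_ge h] at hu
        rw [abs_of_nonpos hu.2, abs_of_nonpos h]; linarith [hu.1]
    have key := (convex_uIcc (0 : ℝ) w).norm_image_sub_le_of_norm_hasDerivWithin_le
      (f := fun u => g 0 u - p u)
      (f' := fun u => g 1 u - ∑ k ∈ Finset.range n, u ^ k • ((k.factorial : ℝ)⁻¹) • g (k + 1) 0)
      (C := C * |w| ^ n) (x := 0) (y := w)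
      (fun u hu => (((hball u (by simpa using (hC0 u hu).trans_lt hw')).2).sub
        (hpd u)).hasDerivWithinAt)
      (fun u hu => by
        have hu' := (hball u (by simpa using (hC0 u hu).trans_lt hw')).1
        refine hu'.trans ?_
        simp only [norm_pow, Real.norm_eq_abs]
        exact mul_le_mul_of_nonneg_left
          (pow_le_pow_left₀ (abs_nonneg u) (hC0 u hu) n) hCnn)
      Set.left_mem_uIcc Set.right_mem_uIcc
    have hp0 : p 0 = g 0 0 := by
      simp only [hp]
      rw [Finset.sum_range_succ']
      simp
    simp only [hp0, sub_self, sub_zero] at key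
    refine key.trans (le_of_eq ?_)
    simp only [Real.norm_eq_abs, pow_succ, mul_assoc, abs_mul, abs_pow]

end Expansion

/-! ### The cusp angle in terms of distances -/

section Cusp

theorem cross_apply_zero (u v : E3) : cross u v 0 = u 1 * v 2 - u 2 * v 1 := by
  simp [cross, cross_apply]

theorem cross_apply_one (u v : E3) : cross u v 1 = u 2 * v 0 - u 0 * v 2 := by
  simp [cross, cross_apply]

theorem cross_apply_two (u v : E3) : cross u v 2 = u 0 * v 1 - u 1 * v 0 := by
  simp [cross, cross_apply]

theorem inner_eq_sum_three (u v : E3) : inner ℝ u v = u 0 * v 0 + u 1 * v 1 + u 2 * v 2 := by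
  simp [PiLp.inner_apply, Fin.sum_univ_three, mul_comm]

theorem cross_cross_left (u v w : E3) :
    cross (cross u v) w = (inner ℝ u w) • v - (inner ℝ v w) • u := by
  ext i
  fin_cases i <;>
  simp [cross_apply_zero, cross_apply_one, cross_apply_two, inner_eq_sum_three] <;> ring

/-- The centre projects onto the midpoint of a chord. This eliminates the circumcentre from the
tangent vectors. -/
theorem inner_sub_eq_half_of_dist_eq {a b c : E3} (h : dist a c = dist b c) :
    inner ℝ (a - b) (c - b) = ‖a - b‖ ^ 2 / 2 := by
  rw [dist_eq_norm, dist_eq_norm] at h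
  have h1 : ‖a - c‖ ^ 2 = ‖a - b‖ ^ 2 - 2 * inner ℝ (a - b) (c - b) + ‖c - b‖ ^ 2 := by
    rw [← norm_sub_sq_real]
    congr 2
    abel
  rw [h, norm_sub_rev b c] at h1
  linarith

theorem angle_normalize_left {V : Type*} [NormedAddCommGroup V] [InnerProductSpace ℝ V]
    (v w : V) : InnerProductGeometry.angle (‖v‖⁻¹ • v) w = InnerProductGeometry.angle v w := by
  rcases eq_or_ne v 0 with rfl | hv
  · simp
  · exact InnerProductGeometry.angle_smul_left_of_pos _ _ (inv_pos.2 (norm_pos_iff.2 hv))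

theorem angle_normalize_right {V : Type*} [NormedAddCommGroup V] [InnerProductSpace ℝ V]
    (v w : V) : InnerProductGeometry.angle v (‖w‖⁻¹ • w) = InnerProductGeometry.angle v w := by
  rw [InnerProductGeometry.angle_comm, angle_normalize_left, InnerProductGeometry.angle_comm]

/-- The triple product formula turns N × (r - c) into a combination of q - p and r - p, whose
coefficients are inner products with r - c, hence half squared chord lengths or differences of
these. -/
theorem circleTangent_last {p q r : E3} (h : AffineIndependent ℝ ![p, q, r]) :
    ∃ v : E3, circleTangent p q r r = ‖v‖⁻¹ • v ∧
      v = (2 : ℝ)⁻¹ • (‖q - r‖ ^ 2 • (p - r) - ‖p - r‖ ^ 2 • (q - r)) := by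
  refine ⟨_, by rw [circleTangent, dif_pos h], ?_⟩
  set S : Affine.Simplex ℝ E3 2 := ⟨![p, q, r], h⟩ with hS
  have hp : dist p S.circumcenter = S.circumradius := S.dist_circumcenter_eq_circumradius 0
  have hq : dist q S.circumcenter = S.circumradius := S.dist_circumcenter_eq_circumradius 1
  have hr : dist r S.circumcenter = S.circumradius := S.dist_circumcenter_eq_circumradius 2
  have h1 := inner_sub_eq_half_of_dist_eq (hp.trans hr.symm)
  have h2 := inner_sub_eq_half_of_dist_eq (hq.trans hr.symm)
  set c := S.circumcenter
  rw [cross_cross_left]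
  have e1 : inner ℝ (q - p) (r - c) = ‖p - r‖ ^ 2 / 2 - ‖q - r‖ ^ 2 / 2 := by
    rw [← h1, ← h2, ← inner_sub_left, ← inner_neg_neg]
    congr 1 <;> abel
  have e2 : inner ℝ (r - p) (r - c) = ‖p - r‖ ^ 2 / 2 := by
    rw [← h1, ← inner_neg_neg]
    congr 1 <;> abel
  rw [e1, e2]
  module

theorem circleTangent_middle {p q r : E3} (h : AffineIndependent ℝ ![p, q, r]) :
    ∃ v : E3, circleTangent p q r q = ‖v‖⁻¹ • v ∧
      v = (2 : ℝ)⁻¹ • (‖p - q‖ ^ 2 • (r - q) - ‖r - q‖ ^ 2 • (p - q)) := by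
  refine ⟨_, by rw [circleTangent, dif_pos h], ?_⟩
  set S : Affine.Simplex ℝ E3 2 := ⟨![p, q, r], h⟩ with hS
  have hp : dist p S.circumcenter = S.circumradius := S.dist_circumcenter_eq_circumradius 0
  have hq : dist q S.circumcenter = S.circumradius := S.dist_circumcenter_eq_circumradius 1
  have hr : dist r S.circumcenter = S.circumradius := S.dist_circumcenter_eq_circumradius 2
  have h1 := inner_sub_eq_half_of_dist_eq (hp.trans hq.symm)
  have h2 := inner_sub_eq_half_of_dist_eq (hr.trans hq.symm)
  set c := S.circumcenter
  rw [cross_cross_left]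
  have e1 : inner ℝ (q - p) (q - c) = ‖p - q‖ ^ 2 / 2 := by
    rw [← h1, ← inner_neg_neg]
    congr 1 <;> abel
  have e2 : inner ℝ (r - p) (q - c) = ‖p - q‖ ^ 2 / 2 - ‖r - q‖ ^ 2 / 2 := by
    rw [← h1, ← h2, ← inner_sub_left, ← inner_neg_neg]
    congr 1 <;> abel
  rw [e1, e2]
  module

/-- The cosine of the cusp angle in terms of the mutual distances of the four points. -/
theorem cos_cuspAngle {x₁ x₂ x₃ x₄ : E3} (h : AffineIndependent ℝ ![x₁, x₂, x₃])
    (h' : AffineIndependent ℝ ![x₂, x₃, x₄]) :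
    Real.cos (cuspAngle x₁ x₂ x₃ x₄) =
      (‖x₁ - x₂‖ ^ 2 * ‖x₃ - x₄‖ ^ 2 + ‖x₁ - x₃‖ ^ 2 * ‖x₂ - x₄‖ ^ 2
        - ‖x₁ - x₄‖ ^ 2 * ‖x₂ - x₃‖ ^ 2) /
      (2 * √((‖x₁ - x₂‖ ^ 2 * ‖x₃ - x₄‖ ^ 2) * (‖x₁ - x₃‖ ^ 2 * ‖x₂ - x₄‖ ^ 2))) := by
  obtain ⟨v, hv, hv'⟩ := circleTangent_last h
  obtain ⟨w, hw, hw'⟩ := circleTangent_middle h'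
  have h23 : x₂ ≠ x₃ := fun e => by
    have := h.injective.ne (show (1 : Fin 3) ≠ 2 by decide)
    simp [e] at this
  have hB : 0 < ‖x₂ - x₃‖ := norm_pos_iff.2 (sub_ne_zero.2 h23)
  rw [cuspAngle, hv, hw, angle_normalize_left, angle_normalize_right,
    InnerProductGeometry.cos_angle]
  rw [norm_sub_rev x₃ x₄]
  have e12 : x₁ - x₂ = (x₁ - x₃) - (x₂ - x₃) := by abel
  have e14 : x₁ - x₄ = (x₁ - x₃) - (x₄ - x₃) := by abel
  have e24 : x₂ - x₄ = (x₂ - x₃) - (x₄ - x₃) := by abel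
  rw [e12, e14, e24]
  generalize x₁ - x₃ = a at *
  generalize x₂ - x₃ = b at *
  generalize x₄ - x₃ = d at *
  -- As under inversion, ‖b‖² a - ‖a‖² b has length ‖a‖ ‖b‖ ‖a - b‖. The root is kept so that the
  -- two norms merge into the single root of the claim.
  have hn : ‖v‖ = √(‖a‖ ^ 2 * ‖b‖ ^ 2 * ‖a - b‖ ^ 2 / 4) := by
    rw [← Real.sqrt_sq (norm_nonneg v)]
    congr 1
    rw [hv', ← real_inner_self_eq_norm_sq]
    simp only [inner_smul_left, inner_smul_right, inner_sub_left, inner_sub_right,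
      real_inner_self_eq_norm_sq, norm_sub_sq_real a b, real_inner_comm b a]
    simp
    ring
  have hm : ‖w‖ = √(‖b‖ ^ 2 * ‖d‖ ^ 2 * ‖b - d‖ ^ 2 / 4) := by
    rw [← Real.sqrt_sq (norm_nonneg w)]
    congr 1
    rw [hw', ← real_inner_self_eq_norm_sq]
    simp only [inner_smul_left, inner_smul_right, inner_sub_left, inner_sub_right,
      real_inner_self_eq_norm_sq, norm_sub_sq_real b d, real_inner_comm d b]
    simp
    ring
  have hi : inner ℝ v w = ‖b‖ ^ 2 / 8 * (‖a - b‖ ^ 2 * ‖d‖ ^ 2 + ‖a‖ ^ 2 * ‖b - d‖ ^ 2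
        - ‖a - d‖ ^ 2 * ‖b‖ ^ 2) := by
    rw [hv', hw']
    simp only [inner_smul_left, inner_smul_right, inner_sub_left, inner_sub_right,
      real_inner_self_eq_norm_sq, norm_sub_sq_real]
    rw [real_inner_comm b a]
    simp
    ring
  have hs : ‖v‖ * ‖w‖ = ‖b‖ ^ 2 / 4 * √((‖a - b‖ ^ 2 * ‖d‖ ^ 2) * (‖a‖ ^ 2 * ‖b - d‖ ^ 2)) := by
    rw [hn, hm, ← Real.sqrt_mul (by positivity), ← Real.sqrt_sq (by positivity : 0 ≤ ‖b‖ ^ 2 / 4),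
      ← Real.sqrt_mul (by positivity)]
    congr 1
    ring
  rw [hs, hi, show ‖b‖ ^ 2 / 8 * (‖a - b‖ ^ 2 * ‖d‖ ^ 2 + ‖a‖ ^ 2 * ‖b - d‖ ^ 2
        - ‖a - d‖ ^ 2 * ‖b‖ ^ 2) = ‖b‖ ^ 2 / 4 * ((‖a - b‖ ^ 2 * ‖d‖ ^ 2 + ‖a‖ ^ 2 * ‖b - d‖ ^ 2
        - ‖a - d‖ ^ 2 * ‖b‖ ^ 2) / 2) by ring, mul_div_mul_left _ _ (by positivity), div_div]

end Cusp

/-! ### Seven-term expansions and the quotient by a square root -/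

section Expansion

/-- The sequence with the given first seven terms, continued by `0`. -/
def coeffs (a₀ a₁ a₂ a₃ a₄ a₅ a₆ : ℝ) : ℕ → ℝ
  | 0 => a₀
  | 1 => a₁
  | 2 => a₂
  | 3 => a₃
  | 4 => a₄
  | 5 => a₅
  | 6 => a₆
  | _ => 0

variable {l : Filter ℝ} {f g : ℝ → ℝ} {a₀ a₁ a₂ a₃ a₄ a₅ a₆ b₀ b₁ b₂ b₃ b₄ b₅ b₆ : ℝ}

theorem HasExpansion.coeffs_mul (hl : l ≤ 𝓝 0)
    (hf : HasExpansion l 7 f (coeffs a₀ a₁ a₂ a₃ a₄ a₅ a₆))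
    (hg : HasExpansion l 7 g (coeffs b₀ b₁ b₂ b₃ b₄ b₅ b₆)) :
    HasExpansion l 7 (fun w => f w * g w)
      (coeffs (a₀ * b₀) (a₀ * b₁ + a₁ * b₀) (a₀ * b₂ + a₁ * b₁ + a₂ * b₀)
        (a₀ * b₃ + a₁ * b₂ + a₂ * b₁ + a₃ * b₀)
        (a₀ * b₄ + a₁ * b₃ + a₂ * b₂ + a₃ * b₁ + a₄ * b₀)
        (a₀ * b₅ + a₁ * b₄ + a₂ * b₃ + a₃ * b₂ + a₄ * b₁ + a₅ * b₀)
        (a₀ * b₆ + a₁ * b₅ + a₂ * b₄ + a₃ * b₃ + a₄ * b₂ + a₅ * b₁ + a₆ * b₀)) := by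
  refine (hf.mul hl hg).congr fun k hk => ?_
  interval_cases k <;> simp [Finset.sum_range_succ, coeffs]

theorem HasExpansion.coeffs_add
    (hf : HasExpansion l 7 f (coeffs a₀ a₁ a₂ a₃ a₄ a₅ a₆))
    (hg : HasExpansion l 7 g (coeffs b₀ b₁ b₂ b₃ b₄ b₅ b₆)) :
    HasExpansion l 7 (fun w => f w + g w)
      (coeffs (a₀ + b₀) (a₁ + b₁) (a₂ + b₂) (a₃ + b₃) (a₄ + b₄) (a₅ + b₅) (a₆ + b₆)) := by
  refine (hf.add hg).congr fun k hk => ?_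
  interval_cases k <;> rfl

theorem HasExpansion.coeffs_sub
    (hf : HasExpansion l 7 f (coeffs a₀ a₁ a₂ a₃ a₄ a₅ a₆))
    (hg : HasExpansion l 7 g (coeffs b₀ b₁ b₂ b₃ b₄ b₅ b₆)) :
    HasExpansion l 7 (fun w => f w - g w)
      (coeffs (a₀ - b₀) (a₁ - b₁) (a₂ - b₂) (a₃ - b₃) (a₄ - b₄) (a₅ - b₅) (a₆ - b₆)) := by
  refine (hf.sub hg).congr fun k hk => ?_
  interval_cases k <;> rfl

theorem HasExpansion.coeffs_congr
    (hf : HasExpansion l 7 f (coeffs a₀ a₁ a₂ a₃ a₄ a₅ a₆))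
    (h₀ : a₀ = b₀) (h₁ : a₁ = b₁) (h₂ : a₂ = b₂) (h₃ : a₃ = b₃) (h₄ : a₄ = b₄) (h₅ : a₅ = b₅)
    (h₆ : a₆ = b₆) : HasExpansion l 7 f (coeffs b₀ b₁ b₂ b₃ b₄ b₅ b₆) := by
  subst h₀ h₁ h₂ h₃ h₄ h₅ h₆
  exact hf

theorem hasExpansion_coeffs (l : Filter ℝ) (a₀ a₁ a₂ a₃ a₄ a₅ a₆ : ℝ) :
    HasExpansion l 7 (fun w => a₀ + w * a₁ + w ^ 2 * a₂ + w ^ 3 * a₃ + w ^ 4 * a₄ + w ^ 5 * a₅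
      + w ^ 6 * a₆) (coeffs a₀ a₁ a₂ a₃ a₄ a₅ a₆) := by
  refine (isBigO_zero (fun w : ℝ => w ^ 7) l).congr_left fun w => ?_
  simp [Finset.sum_range_succ, coeffs]

/-- If `n² = 4 μ p²` up to order `7`, then `n / (2 √μ)` equals `p` up to order `7`. -/
theorem isBigO_div_sqrt_sub (hl : l ≤ 𝓝 0) {n μ p : ℝ → ℝ}
    (hn : HasExpansion l 7 n (coeffs a₀ a₁ a₂ a₃ a₄ a₅ a₆))
    (hμ : HasExpansion l 7 μ (coeffs b₀ b₁ b₂ b₃ b₄ b₅ b₆)) (ha : 1 < a₀) (hb : 1 < b₀)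
    (hp : Filter.Tendsto p l (𝓝 1))
    (h : (fun w => n w ^ 2 - 4 * μ w * p w ^ 2) =O[l] (fun w => w ^ 7)) :
    (fun w => n w / (2 * √(μ w)) - p w) =O[l] (fun w => w ^ 7) := by
  refine IsBigO.trans (IsBigO.of_bound 1 ?_) h
  have hn' : Filter.Tendsto n l (𝓝 a₀) := hn.tendsto hl
  have hμ' : Filter.Tendsto μ l (𝓝 b₀) := hμ.tendsto hl
  filter_upwards [hn'.eventually (lt_mem_nhds ha), hμ'.eventually (lt_mem_nhds hb),
    hp.eventually (lt_mem_nhds zero_lt_one)] with w h1 h2 h3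
  have hr : 1 ≤ √(μ w) := by rw [Real.one_le_sqrt]; exact h2.le
  have hr2 : √(μ w) ^ 2 = μ w := Real.sq_sqrt (by linarith)
  have hd : 1 ≤ 2 * √(μ w) * (n w + 2 * √(μ w) * p w) := by
    have : 0 < √(μ w) * p w := by positivity
    nlinarith
  -- Multiplying by the conjugate avoids expanding the root; the denominator is eventually at least
  -- 1, so the error is bounded by that of n² - 4μp².
  have e : n w / (2 * √(μ w)) - p w
      = (n w ^ 2 - 4 * μ w * p w ^ 2) / (2 * √(μ w) * (n w + 2 * √(μ w) * p w)) := by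
    have h5 : n w + 2 * √(μ w) * p w ≠ 0 := by
      intro h0
      rw [h0] at hd
      norm_num at hd
    have h6 : √(μ w) ≠ 0 := by positivity
    clear hd
    generalize √(μ w) = r at *
    rw [← hr2]
    field_simp
    ring
  rw [e, norm_div, one_mul]
  exact div_le_self (norm_nonneg _) (by rw [Real.norm_eq_abs]; exact hd.trans (le_abs_self _))

end Expansion

/-! ### Gram numbers of a normalised curve in the light cone -/

section Gram

/-- The Gram numbers of successive derivatives of a curve in the light cone that is parametrised
by conformal length: derivatives are `φ⁻¹ • d/ds`, and `q k` are those of `b 2 2`. -/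
structure IsGramChain (I : Set ℝ) (φ : ℝ → ℝ) (b : ℕ → ℕ → ℝ → ℝ) (q : ℕ → ℝ → ℝ) : Prop where
  isOpen : IsOpen I
  ne_zero : ∀ s ∈ I, φ s ≠ 0
  symm : ∀ k l s, b k l s = b l k s
  hasDerivAt : ∀ k l, ∀ s ∈ I, HasDerivAt (b k l) (φ s * (b (k + 1) l s + b k (l + 1) s)) s
  hasDerivAt_q : ∀ k, ∀ s ∈ I, HasDerivAt (q k) (φ s * q (k + 1) s) s
  b00 : ∀ s ∈ I, b 0 0 s = 0
  b11 : ∀ s ∈ I, b 1 1 s = 1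
  b22 : ∀ s ∈ I, b 2 2 s = q 0 s
  b33 : ∀ s ∈ I, b 3 3 s = 1 + q 0 s ^ 2

namespace IsGramChain

variable {I : Set ℝ} {φ : ℝ → ℝ} {b : ℕ → ℕ → ℝ → ℝ} {q : ℕ → ℝ → ℝ}

/-- This is the product rule with the factor φ cancelled: a formula for one Gram number gives a
linear relation between two of the next total order. -/
theorem add_eq (h : IsGramChain I φ b q) {k l : ℕ} {f f' : ℝ → ℝ}
    (hf : ∀ s ∈ I, b k l s = f s) (hf' : ∀ s ∈ I, HasDerivAt f (φ s * f' s) s) :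
    ∀ s ∈ I, b (k + 1) l s + b k (l + 1) s = f' s := by
  intro s hs
  have h1 : HasDerivAt (b k l) (φ s * f' s) s := by
    refine (hf' s hs).congr_of_eventuallyEq ?_
    filter_upwards [h.isOpen.mem_nhds hs] with u hu
    exact hf u hu
  exact mul_left_cancel₀ (h.ne_zero s hs) ((h.hasDerivAt k l s hs).unique h1)

variable (h : IsGramChain I φ b q)
include h

/-- Each total order is worked through from the middle outwards. In odd order symmetry makes the
middle number half of a derivative; in even order the middle one is the given diagonal number. -/
theorem b01 : ∀ s ∈ I, b 0 1 s = 0 := fun s hs => by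
  have := h.add_eq (f' := fun _ => 0) h.b00
    (fun s _ => by simpa using hasDerivAt_const s (0 : ℝ)) s hs
  have := h.symm 1 0 s
  simp only [zero_add] at *
  linarith

theorem b02 : ∀ s ∈ I, b 0 2 s = -1 := fun s hs => by
  have := h.add_eq (f' := fun _ => 0) h.b01
    (fun s _ => by simpa using hasDerivAt_const s (0 : ℝ)) s hs
  have := h.b11 s hs
  norm_num at *
  linarith

theorem b12 : ∀ s ∈ I, b 1 2 s = 0 := fun s hs => by
  have := h.add_eq (f' := fun _ => 0) h.b11
    (fun s _ => by simpa using hasDerivAt_const s (1 : ℝ)) s hs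
  have := h.symm 2 1 s
  norm_num at *
  linarith

theorem b03 : ∀ s ∈ I, b 0 3 s = 0 := fun s hs => by
  have := h.add_eq (f' := fun _ => 0) h.b02
    (fun s _ => by simpa using hasDerivAt_const s (-1 : ℝ)) s hs
  have := h.b12 s hs
  norm_num at *
  linarith

theorem b13 : ∀ s ∈ I, b 1 3 s = -q 0 s := fun s hs => by
  have := h.add_eq (f' := fun _ => 0) h.b12
    (fun s _ => by simpa using hasDerivAt_const s (0 : ℝ)) s hs
  have := h.b22 s hs
  norm_num at *
  linarith

theorem b04 : ∀ s ∈ I, b 0 4 s = q 0 s := fun s hs => by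
  have := h.add_eq (f' := fun _ => 0) h.b03
    (fun s _ => by simpa using hasDerivAt_const s (0 : ℝ)) s hs
  have := h.b13 s hs
  norm_num at *
  linarith

theorem b23 : ∀ s ∈ I, b 2 3 s = q 1 s / 2 := fun s hs => by
  have := h.add_eq h.b22 (h.hasDerivAt_q 0) s hs
  have := h.symm 3 2 s
  norm_num at *
  linarith

theorem b14 : ∀ s ∈ I, b 1 4 s = -3 / 2 * q 1 s := fun s hs => by
  have := h.add_eq (f' := fun s => - q 1 s) h.b13
    (fun s hs => (h.hasDerivAt_q 0 s hs).fun_neg.congr_deriv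
      (by ring)) s hs
  have := h.b23 s hs
  norm_num at *
  linarith

theorem b05 : ∀ s ∈ I, b 0 5 s = 5 / 2 * q 1 s := fun s hs => by
  have := h.add_eq h.b04 (h.hasDerivAt_q 0) s hs
  have := h.b14 s hs
  norm_num at *
  linarith

theorem b24 : ∀ s ∈ I, b 2 4 s = q 2 s / 2 - (1 + q 0 s ^ 2) := fun s hs => by
  have := h.add_eq (f' := fun s => q 2 s / 2) h.b23
    (fun s hs => ((h.hasDerivAt_q 1 s hs).div_const 2).congr_deriv
      (by ring)) s hs
  have := h.b33 s hs
  norm_num at *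
  linarith

theorem b15 : ∀ s ∈ I, b 1 5 s = -2 * q 2 s + (1 + q 0 s ^ 2) := fun s hs => by
  have := h.add_eq (f' := fun s => -3 / 2 * q 2 s) h.b14
    (fun s hs => ((h.hasDerivAt_q 1 s hs).const_mul (-3 / 2)).congr_deriv
      (by ring)) s hs
  have := h.b24 s hs
  norm_num at *
  linarith

theorem b06 : ∀ s ∈ I, b 0 6 s = 9 / 2 * q 2 s - (1 + q 0 s ^ 2) := fun s hs => by
  have := h.add_eq (f' := fun s => 5 / 2 * q 2 s) h.b05
    (fun s hs => ((h.hasDerivAt_q 1 s hs).const_mul (5 / 2)).congr_deriv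
      (by ring)) s hs
  have := h.b15 s hs
  norm_num at *
  linarith

theorem hasDerivAt_sq : ∀ s ∈ I,
    HasDerivAt (fun s => 1 + q 0 s ^ 2) (φ s * (2 * q 0 s * q 1 s)) s := fun s hs => by
  exact (((h.hasDerivAt_q 0 s hs).fun_pow 2).const_add 1).congr_deriv (by norm_num; ring)

theorem b34 : ∀ s ∈ I, b 3 4 s = q 0 s * q 1 s := fun s hs => by
  have := h.add_eq h.b33 h.hasDerivAt_sq s hs
  have := h.symm 4 3 s
  norm_num at *
  linarith

theorem b25 : ∀ s ∈ I, b 2 5 s = q 3 s / 2 - 3 * (q 0 s * q 1 s) := fun s hs => by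
  have := h.add_eq (f' := fun s => q 3 s / 2 - 2 * q 0 s * q 1 s) h.b24
    (fun s hs => (((h.hasDerivAt_q 2 s hs).div_const 2).fun_sub (h.hasDerivAt_sq s hs)).congr_deriv
      (by ring)) s hs
  have := h.b34 s hs
  norm_num at *
  linarith

theorem b16 : ∀ s ∈ I, b 1 6 s = -5 / 2 * q 3 s + 5 * (q 0 s * q 1 s) := fun s hs => by
  have := h.add_eq (f' := fun s => -2 * q 3 s + 2 * q 0 s * q 1 s) h.b15
    (fun s hs => (((h.hasDerivAt_q 2 s hs).const_mul (-2)).fun_add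
      (h.hasDerivAt_sq s hs)).congr_deriv
      (by ring)) s hs
  have := h.b25 s hs
  norm_num at *
  linarith

theorem b07 : ∀ s ∈ I, b 0 7 s = 7 * q 3 s - 7 * (q 0 s * q 1 s) := fun s hs => by
  have := h.add_eq (f' := fun s => 9 / 2 * q 3 s - 2 * q 0 s * q 1 s) h.b06
    (fun s hs => (((h.hasDerivAt_q 2 s hs).const_mul (9 / 2)).fun_sub
      (h.hasDerivAt_sq s hs)).congr_deriv
      (by ring)) s hs
  have := h.b16 s hs
  norm_num at *
  linarith

theorem hasDerivAt_mul : ∀ s ∈ I,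
    HasDerivAt (fun s => q 0 s * q 1 s) (φ s * (q 1 s ^ 2 + q 0 s * q 2 s)) s := fun s hs =>
  ((h.hasDerivAt_q 0 s hs).fun_mul (h.hasDerivAt_q 1 s hs)).congr_deriv (by ring)

/-- In total order 8 the diagonal number `b 4 4` is not among the data and stays as a parameter; the
conformal torsion enters through it. -/
theorem b35 : ∀ s ∈ I, b 3 5 s = q 1 s ^ 2 + q 0 s * q 2 s - b 4 4 s := fun s hs => by
  have := h.add_eq h.b34 h.hasDerivAt_mul s hs
  norm_num at *
  linarith

theorem b26 : ∀ s ∈ I, b 2 6 s = q 4 s / 2 - 4 * (q 1 s ^ 2 + q 0 s * q 2 s) + b 4 4 s :=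
  fun s hs => by
  have := h.add_eq (f' := fun s => q 4 s / 2 - 3 * (q 1 s ^ 2 + q 0 s * q 2 s)) h.b25
    (fun s hs => (((h.hasDerivAt_q 3 s hs).div_const 2).fun_sub
        ((h.hasDerivAt_mul s hs).const_mul 3)).congr_deriv
      (by ring)) s hs
  have := h.b35 s hs
  norm_num at *
  linarith

theorem b17 : ∀ s ∈ I, b 1 7 s = -3 * q 4 s + 9 * (q 1 s ^ 2 + q 0 s * q 2 s) - b 4 4 s :=
  fun s hs => by
  have := h.add_eq (f' := fun s => -5 / 2 * q 4 s + 5 * (q 1 s ^ 2 + q 0 s * q 2 s)) h.b16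
    (fun s hs => (((h.hasDerivAt_q 3 s hs).const_mul (-5 / 2)).fun_add
        ((h.hasDerivAt_mul s hs).const_mul 5)).congr_deriv
      (by ring)) s hs
  have := h.b26 s hs
  norm_num at *
  linarith

theorem b08 : ∀ s ∈ I, b 0 8 s = 10 * q 4 s - 16 * (q 1 s ^ 2 + q 0 s * q 2 s) + b 4 4 s :=
  fun s hs => by
  have := h.add_eq (f' := fun s => 7 * q 4 s - 7 * (q 1 s ^ 2 + q 0 s * q 2 s)) h.b07
    (fun s hs => (((h.hasDerivAt_q 3 s hs).const_mul 7).fun_sub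
        ((h.hasDerivAt_mul s hs).const_mul 7)).congr_deriv
      (by ring)) s hs
  have := h.b17 s hs
  norm_num at *
  linarith

end IsGramChain

end Gram

/-! ### Expansion of the chords and of the cosine -/

section CosExpansion

variable {W : Type*} [NormedAddCommGroup W] [NormedSpace ℝ W]
  {I : Set ℝ} {φ : ℝ → ℝ} {b : ℕ → ℕ → ℝ → ℝ} {q : ℕ → ℝ → ℝ}

/-- The expansion of the normalised squared chord between the parameters `i w` and `j w`. -/
theorem IsGramChain.hasExpansion_chord (h : IsGramChain I φ b q) {s : ℝ} (hs : s ∈ I)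
    (B : W →L[ℝ] W →L[ℝ] ℝ) (g : ℕ → ℝ → W)
    (hg : ∀ k, ∀ᶠ w in 𝓝 (0 : ℝ), HasDerivAt (g k) (g (k + 1) w) w)
    (hb : ∀ k l, B (g k 0) (g l 0) = b k l s) (i j : ℝ) :
    HasExpansion (𝓝[≠] 0) 7 (fun w => (-2 * B (g 0 (i * w)) (g 0 (j * w))) / w ^ 2)
      (coeffs ((i - j) ^ 2) 0 (-(q 0 s / 12) * (i - j) ^ 4)
        (-(q 1 s / 24) * (i + j) * (i - j) ^ 4)
        (-2 * ((9 / 2 * q 2 s - (1 + q 0 s ^ 2)) * (i ^ 6 + j ^ 6) / 720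
          + (-2 * q 2 s + (1 + q 0 s ^ 2)) * (i * j ^ 5 + i ^ 5 * j) / 120
          + (q 2 s / 2 - (1 + q 0 s ^ 2)) * (i ^ 2 * j ^ 4 + i ^ 4 * j ^ 2) / 48
          + (1 + q 0 s ^ 2) * (i ^ 3 * j ^ 3) / 36))
        (-2 * ((7 * q 3 s - 7 * (q 0 s * q 1 s)) * (i ^ 7 + j ^ 7) / 5040
          + (-5 / 2 * q 3 s + 5 * (q 0 s * q 1 s)) * (i * j ^ 6 + i ^ 6 * j) / 720
          + (q 3 s / 2 - 3 * (q 0 s * q 1 s)) * (i ^ 2 * j ^ 5 + i ^ 5 * j ^ 2) / 240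
          + q 0 s * q 1 s * (i ^ 3 * j ^ 4 + i ^ 4 * j ^ 3) / 144))
        (-2 * ((10 * q 4 s - 16 * (q 1 s ^ 2 + q 0 s * q 2 s) + b 4 4 s) * (i ^ 8 + j ^ 8) / 40320
          + (-3 * q 4 s + 9 * (q 1 s ^ 2 + q 0 s * q 2 s) - b 4 4 s)
            * (i * j ^ 7 + i ^ 7 * j) / 5040
          + (q 4 s / 2 - 4 * (q 1 s ^ 2 + q 0 s * q 2 s) + b 4 4 s)
            * (i ^ 2 * j ^ 6 + i ^ 6 * j ^ 2) / 1440
          + (q 1 s ^ 2 + q 0 s * q 2 s - b 4 4 s) * (i ^ 3 * j ^ 5 + i ^ 5 * j ^ 3) / 720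
          + b 4 4 s * (i ^ 4 * j ^ 4) / 576))) := by
  -- Order 9 is needed because the division by w² costs two orders; it is possible since `b 0 0` and
  -- `b 0 1` vanish.
  have h1 := hasExpansion_of_hasDerivAt g hg 9
  have h2 := ((h1.comp_mul i).bilin le_rfl B (h1.comp_mul j)).const_smul (-2)
  simp only [map_smul, smul_apply, smul_eq_mul, hb] at h2
  have b00 := h.b00 s hs
  have b01 := h.b01 s hs
  have b11 := h.b11 s hs
  have b02 := h.b02 s hs
  have b12 := h.b12 s hs
  have b03 := h.b03 s hs
  have b22 := h.b22 s hs
  have b13 := h.b13 s hs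
  have b04 := h.b04 s hs
  have b23 := h.b23 s hs
  have b14 := h.b14 s hs
  have b05 := h.b05 s hs
  have b33 := h.b33 s hs
  have b24 := h.b24 s hs
  have b15 := h.b15 s hs
  have b06 := h.b06 s hs
  have b34 := h.b34 s hs
  have b25 := h.b25 s hs
  have b16 := h.b16 s hs
  have b07 := h.b07 s hs
  have b35 := h.b35 s hs
  have b26 := h.b26 s hs
  have b17 := h.b17 s hs
  have b08 := h.b08 s hs
  have s01 := h.symm 1 0 s
  have s02 := h.symm 2 0 s
  have s12 := h.symm 2 1 s
  have s03 := h.symm 3 0 s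
  have s13 := h.symm 3 1 s
  have s04 := h.symm 4 0 s
  have s23 := h.symm 3 2 s
  have s14 := h.symm 4 1 s
  have s05 := h.symm 5 0 s
  have s24 := h.symm 4 2 s
  have s15 := h.symm 5 1 s
  have s06 := h.symm 6 0 s
  have s34 := h.symm 4 3 s
  have s25 := h.symm 5 2 s
  have s16 := h.symm 6 1 s
  have s07 := h.symm 7 0 s
  have s35 := h.symm 5 3 s
  have s26 := h.symm 6 2 s
  have s17 := h.symm 7 1 s
  have s08 := h.symm 8 0 s
  have h3 := h2.inv_pow_smul (m := 2) (n := 7) fun k hk => by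
    interval_cases k <;> simp [Finset.sum_range_succ, b00, b01, s01]
  simp only [smul_eq_mul, inv_mul_eq_div] at h3
  refine h3.congr fun k hk => ?_
  interval_cases k <;>
  · simp only [Finset.sum_range_succ, Finset.sum_range_zero, coeffs, Nat.factorial, Nat.reduceAdd,
      Nat.reduceSub, Nat.sub_zero, Nat.sub_self, *]
    norm_num
    try ring

/-- The expansion of the cross-ratio expression for the cosine of the cusp angle. -/
theorem IsGramChain.isBigO_cos (h : IsGramChain I φ b q) {s : ℝ} (hs : s ∈ I)
    (B : W →L[ℝ] W →L[ℝ] ℝ) (g : ℕ → ℝ → W)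
    (hg : ∀ k, ∀ᶠ w in 𝓝 (0 : ℝ), HasDerivAt (g k) (g (k + 1) w) w)
    (hb : ∀ k l, B (g k 0) (g l 0) = b k l s) {t : ℝ}
    (hb44 : b 4 4 s = t + 9 / 4 * q 1 s ^ 2 + q 0 s ^ 3 + 2 * q 0 s - q 0 s * q 2 s)
    (d : ℝ → ℝ → ℝ → ℝ) (hd : ∀ i j w, d i j w = -2 * B (g 0 (i * w)) (g 0 (j * w))) :
    (fun w => (d (-2) (-1) w * d 0 1 w + d (-2) 0 w * d (-1) 1 w - d (-2) 1 w * d (-1) 0 w) /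
        (2 * √((d (-2) (-1) w * d 0 1 w) * (d (-2) 0 w * d (-1) 1 w)))
      - (1 - w ^ 4 / 8 + (-(q 0 s) / 2 + 3 / 4 * t) / 24 * w ^ 6))
    =O[𝓝[≠] 0] (fun w => w ^ 7) := by
  have hl : 𝓝[≠] (0 : ℝ) ≤ 𝓝 0 := nhdsWithin_le_nhds
  have H := fun i j => h.hasExpansion_chord hs B g hg hb i j
  simp only [← hd] at H
  have H12 := (H (-2) (-1)).coeffs_congr (b₀ := 1)
    (b₁ := 0)
    (b₂ := -1 / 12 * q 0 s)
    (b₃ := 1 / 8 * q 1 s)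
    (b₄ := 1 / 360 + 1 / 360 * q 0 s ^ 2 - 23 / 240 * q 2 s)
    (b₅ := -1 / 120 * q 0 s * q 1 s + 1 / 20 * q 3 s)
    (b₆ := -1 / 20160 * b 4 4 s + 2 / 315 * q 0 s * q 2 s + 2 / 315 * q 1 s ^ 2 - 67 / 3360 * q 4 s)
    (by ring) (by ring) (by ring) (by ring) (by ring) (by ring) (by ring)
  have H34 := (H (0) (1)).coeffs_congr (b₀ := 1)
    (b₁ := 0)
    (b₂ := -1 / 12 * q 0 s)
    (b₃ := -1 / 24 * q 1 s)
    (b₄ := 1 / 360 + 1 / 360 * q 0 s ^ 2 - 1 / 80 * q 2 s)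
    (b₅ := 1 / 360 * q 0 s * q 1 s - 1 / 360 * q 3 s)
    (b₆ := -1 / 20160 * b 4 4 s + 1 / 1260 * q 0 s * q 2 s + 1 / 1260 * q 1 s ^ 2
      - 1 / 2016 * q 4 s)
    (by ring) (by ring) (by ring) (by ring) (by ring) (by ring) (by ring)
  have H13 := (H (-2) (0)).coeffs_congr (b₀ := 4)
    (b₁ := 0)
    (b₂ := -4 / 3 * q 0 s)
    (b₃ := 4 / 3 * q 1 s)
    (b₄ := 8 / 45 + 8 / 45 * q 0 s ^ 2 - 4 / 5 * q 2 s)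
    (b₅ := -16 / 45 * q 0 s * q 1 s + 16 / 45 * q 3 s)
    (b₆ := -4 / 315 * b 4 4 s + 64 / 315 * q 0 s * q 2 s + 64 / 315 * q 1 s ^ 2 - 8 / 63 * q 4 s)
    (by ring) (by ring) (by ring) (by ring) (by ring) (by ring) (by ring)
  have H24 := (H (-1) (1)).coeffs_congr (b₀ := 4)
    (b₁ := 0)
    (b₂ := -4 / 3 * q 0 s)
    (b₃ := 0)
    (b₄ := 8 / 45 + 8 / 45 * q 0 s ^ 2 - 2 / 15 * q 2 s)
    (b₅ := 0)
    (b₆ := -4 / 315 * b 4 4 s + 8 / 315 * q 0 s * q 2 s + 8 / 315 * q 1 s ^ 2 - 1 / 210 * q 4 s)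
    (by ring) (by ring) (by ring) (by ring) (by ring) (by ring) (by ring)
  have H14 := (H (-2) (1)).coeffs_congr (b₀ := 9)
    (b₁ := 0)
    (b₂ := -27 / 4 * q 0 s)
    (b₃ := 27 / 8 * q 1 s)
    (b₄ := 81 / 40 + 81 / 40 * q 0 s ^ 2 - 189 / 80 * q 2 s)
    (b₅ := -81 / 40 * q 0 s * q 1 s + 9 / 10 * q 3 s)
    (b₆ := -729 / 2240 * b 4 4 s + 81 / 70 * q 0 s * q 2 s + 81 / 70 * q 1 s ^ 2
      - 369 / 1120 * q 4 s)
    (by ring) (by ring) (by ring) (by ring) (by ring) (by ring) (by ring)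
  have H23 := (H (-1) (0)).coeffs_congr (b₀ := 1)
    (b₁ := 0)
    (b₂ := -1 / 12 * q 0 s)
    (b₃ := 1 / 24 * q 1 s)
    (b₄ := 1 / 360 + 1 / 360 * q 0 s ^ 2 - 1 / 80 * q 2 s)
    (b₅ := -1 / 360 * q 0 s * q 1 s + 1 / 360 * q 3 s)
    (b₆ := -1 / 20160 * b 4 4 s + 1 / 1260 * q 0 s * q 2 s + 1 / 1260 * q 1 s ^ 2
      - 1 / 2016 * q 4 s)
    (by ring) (by ring) (by ring) (by ring) (by ring) (by ring) (by ring)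
  have HX := H12.coeffs_mul hl H34
  have HY := H13.coeffs_mul hl H24
  have HN := (HX.coeffs_add HY).coeffs_sub (H14.coeffs_mul hl H23)
  have HM := HX.coeffs_mul hl HY
  have HP := hasExpansion_coeffs (𝓝[≠] 0) 1 0 0 0 (-1 / 8) 0 ((-(q 0 s) / 2 + 3 / 4 * t) / 24)
  have H4 := hasExpansion_coeffs (𝓝[≠] 0) 4 0 0 0 0 0 0
  have HD := (HN.coeffs_mul hl HN).coeffs_sub
    ((H4.coeffs_mul hl HM).coeffs_mul hl (HP.coeffs_mul hl HP))
  -- For the numerator n, the product μ under the root and the claimed polynomial p, this says that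
  -- n² - 4μp² vanishes to order 7. Only the coefficient of w⁶ needs the value of `b 4 4`.
  have HZ := HD.coeffs_congr (b₀ := 0) (b₁ := 0) (b₂ := 0) (b₃ := 0) (b₄ := 0) (b₅ := 0) (b₆ := 0)
    (by norm_num) (by norm_num) (by ring) (by ring) (by ring) (by ring) (by rw [hb44]; ring)
  have HZ' := HZ.isBigO
  have key := isBigO_div_sqrt_sub hl HN HM (by norm_num) (by norm_num) (HP.tendsto hl) (by
    refine HZ'.congr_left fun w => ?_
    have : ∀ k ∈ Finset.range 7, w ^ k • coeffs 0 0 0 0 0 0 0 k = 0 := by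
      intro k hk
      have := Finset.mem_range.1 hk
      interval_cases k <;> simp [coeffs]
    rw [Finset.sum_eq_zero this]
    ring)
  refine key.congr' ?_ Filter.EventuallyEq.rfl
  filter_upwards [self_mem_nhdsWithin] with w hw
  have hw0 : w ≠ 0 := hw
  -- Dividing every chord by w² scales the numerator and the root by the same factor w⁻⁴.
  have e : d (-2) (-1) w / w ^ 2 * (d 0 1 w / w ^ 2) * (d (-2) 0 w / w ^ 2 * (d (-1) 1 w / w ^ 2))
      = (d (-2) (-1) w * d 0 1 w) * (d (-2) 0 w * d (-1) 1 w) / (w ^ 4) ^ 2 := by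
    field_simp
  rw [e, Real.sqrt_div' _ (by positivity), Real.sqrt_sq (by positivity)]
  congr 1
  · field_simp
  · ring

end CosExpansion

/-! ### Smoothness and the Frenet–Serret equations -/

section Frenet

/-- A curve parametrised by arc length, with positive curvature and without vertices. -/
structure IsVertexFree (I : Set ℝ) (x : ℝ → E3) : Prop where
  isOpen : IsOpen I
  contDiffOn : ContDiffOn ℝ ∞ x I
  norm_deriv : ∀ s ∈ I, ‖deriv x s‖ = 1
  curvature_pos : ∀ s ∈ I, 0 < curvature x s
  nu_pos : ∀ s ∈ I, 0 < nu (curvature x) (torsion x) s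

theorem _root_.ContDiffOn.hasDerivAt_of_isOpen {F : Type*} [NormedAddCommGroup F]
    [NormedSpace ℝ F] {f : ℝ → F} {I : Set ℝ} (hI : IsOpen I) (hf : ContDiffOn ℝ ∞ f I) {s : ℝ}
    (hs : s ∈ I) : HasDerivAt f (deriv f s) s :=
  ((hf.contDiffAt (hI.mem_nhds hs)).differentiableAt (by simp)).hasDerivAt

theorem _root_.ContDiffOn.deriv_infty {F : Type*} [NormedAddCommGroup F]
    [NormedSpace ℝ F] {f : ℝ → F} {I : Set ℝ} (hI : IsOpen I) (hf : ContDiffOn ℝ ∞ f I) :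
    ContDiffOn ℝ ∞ (deriv f) I :=
  hf.deriv_of_isOpen hI (by simp)

theorem _root_.HasDerivAt.congr_on {F : Type*} [NormedAddCommGroup F]
    [NormedSpace ℝ F] {f g : ℝ → F} {f' : F} {I : Set ℝ} (hI : IsOpen I) {s : ℝ} (hs : s ∈ I)
    (hg : HasDerivAt g f' s) (h : ∀ u ∈ I, f u = g u) : HasDerivAt f f' s :=
  hg.congr_of_eventuallyEq (Filter.eventually_of_mem (hI.mem_nhds hs) h)

theorem contDiffOn_cross {I : Set ℝ} {u v : ℝ → E3} (hu : ContDiffOn ℝ ∞ u I)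
    (hv : ContDiffOn ℝ ∞ v I) : ContDiffOn ℝ ∞ (fun s => cross (u s) (v s)) I := by
  have hu' := contDiffOn_euclidean.1 hu
  have hv' := contDiffOn_euclidean.1 hv
  refine contDiffOn_euclidean.2 fun i => ?_
  fin_cases i
  · simpa only [Fin.zero_eta, cross_apply_zero] using
      ((hu' 1).mul (hv' 2)).sub ((hu' 2).mul (hv' 1))
  · simpa only [Fin.mk_one, cross_apply_one] using
      ((hu' 2).mul (hv' 0)).sub ((hu' 0).mul (hv' 2))
  · simpa only [Fin.reduceFinMk, cross_apply_two] using
      ((hu' 0).mul (hv' 1)).sub ((hu' 1).mul (hv' 0))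

theorem inner_cross_self_left (u v : E3) : inner ℝ u (cross u v) = 0 := by
  rw [inner_eq_sum_three, cross_apply_zero, cross_apply_one, cross_apply_two]
  ring

theorem inner_cross_self_right (u v : E3) : inner ℝ v (cross u v) = 0 := by
  rw [inner_eq_sum_three, cross_apply_zero, cross_apply_one, cross_apply_two]
  ring

theorem inner_cross_cross_self (u v : E3) :
    inner ℝ (cross u v) (cross u v) = inner ℝ u u * inner ℝ v v - inner ℝ u v ^ 2 := by
  simp only [inner_eq_sum_three, cross_apply_zero, cross_apply_one, cross_apply_two]
  ring

/-- The expansion of a vector in the orthonormal frame `u`, `v`, `u × v`. -/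
theorem eq_sum_inner_smul_of_orthonormal {u v : E3} (hu : inner ℝ u u = (1 : ℝ))
    (hv : inner ℝ v v = (1 : ℝ)) (huv : inner ℝ u v = (0 : ℝ)) (w : E3) :
    w = (inner ℝ u w : ℝ) • u + (inner ℝ v w : ℝ) • v
      + (inner ℝ (cross u v) w : ℝ) • cross u v := by
  have hb : inner ℝ (cross u v) (cross u v) = (1 : ℝ) := by
    rw [inner_cross_cross_self, hu, hv, huv]; norm_num
  have hub := inner_cross_self_left u v
  have hvb := inner_cross_self_right u v
  have ho : Orthonormal ℝ ![u, v, cross u v] := by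
    rw [orthonormal_iff_ite]
    intro i j
    fin_cases i <;> fin_cases j <;>
    simp [-inner_self_eq_norm_sq_to_K, hu, hv, huv, hub, hvb, hb, real_inner_comm u v,
      real_inner_comm u (cross u v),
      real_inner_comm v (cross u v)]
  let e := (basisOfOrthonormalOfCardEqFinrank ho (by simp)).toOrthonormalBasis (by
    simpa using ho)
  have := e.sum_repr' w
  rw [Fin.sum_univ_three] at this
  simpa [e] using this.symm

variable {I : Set ℝ} {x : ℝ → E3}

theorem nu_sq (κ τ : ℝ → ℝ) (s : ℝ) : nu κ τ s ^ 2 = deriv κ s ^ 2 + κ s ^ 2 * τ s ^ 2 :=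
  Real.sq_sqrt (by positivity)

theorem inner_tangent_binormal (x : ℝ → E3) (s : ℝ) :
    inner ℝ (tangent x s) (binormal x s) = (0 : ℝ) :=
  inner_cross_self_left _ _

theorem inner_normal_binormal (x : ℝ → E3) (s : ℝ) :
    inner ℝ (normal x s) (binormal x s) = (0 : ℝ) :=
  inner_cross_self_right _ _

namespace IsVertexFree

variable (h : IsVertexFree I x)
include h

theorem contDiffOn_tangent : ContDiffOn ℝ ∞ (tangent x) I :=
  h.contDiffOn.deriv_infty h.isOpen

theorem contDiffOn_curvature : ContDiffOn ℝ ∞ (curvature x) I :=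
  (h.contDiffOn_tangent.deriv_infty h.isOpen).norm ℝ fun s hs =>
    norm_pos_iff.1 (h.curvature_pos s hs)

theorem contDiffOn_normal : ContDiffOn ℝ ∞ (normal x) I :=
  (h.contDiffOn_curvature.inv fun s hs => (h.curvature_pos s hs).ne').smul
    (h.contDiffOn_tangent.deriv_infty h.isOpen)

theorem contDiffOn_binormal : ContDiffOn ℝ ∞ (binormal x) I :=
  contDiffOn_cross h.contDiffOn_tangent h.contDiffOn_normal

theorem contDiffOn_torsion : ContDiffOn ℝ ∞ (torsion x) I :=
  (h.contDiffOn_normal.deriv_infty h.isOpen).inner ℝ h.contDiffOn_binormal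

theorem contDiffOn_nu : ContDiffOn ℝ ∞ (nu (curvature x) (torsion x)) I := by
  refine ContDiffOn.sqrt ?_ fun s hs h0 => ?_
  · exact ((h.contDiffOn_curvature.deriv_infty h.isOpen).pow 2).add
      ((h.contDiffOn_curvature.pow 2).mul (h.contDiffOn_torsion.pow 2))
  · have := h.nu_pos s hs
    rw [nu, h0, Real.sqrt_zero] at this
    exact lt_irrefl _ this

theorem inner_tangent_tangent {s : ℝ} (hs : s ∈ I) :
    inner ℝ (tangent x s) (tangent x s) = (1 : ℝ) := by
  rw [real_inner_self_eq_norm_sq, tangent, h.norm_deriv s hs, one_pow]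

theorem hasDerivAt_tangent {s : ℝ} (hs : s ∈ I) :
    HasDerivAt (tangent x) (curvature x s • normal x s) s := by
  have := h.contDiffOn_tangent.hasDerivAt_of_isOpen h.isOpen hs
  rwa [normal, smul_inv_smul₀ (h.curvature_pos s hs).ne']

theorem inner_normal_normal {s : ℝ} (hs : s ∈ I) :
    inner ℝ (normal x s) (normal x s) = (1 : ℝ) := by
  have := (h.curvature_pos s hs).ne'
  rw [real_inner_self_eq_norm_sq, normal, norm_smul, norm_inv, ← curvature,
    Real.norm_of_nonneg (h.curvature_pos s hs).le, inv_mul_cancel₀ this, one_pow]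

theorem inner_tangent_normal {s : ℝ} (hs : s ∈ I) :
    inner ℝ (tangent x s) (normal x s) = (0 : ℝ) := by
  have h1 := (h.hasDerivAt_tangent hs).inner ℝ (h.hasDerivAt_tangent hs)
  have h2 := (hasDerivAt_const s (1 : ℝ)).congr_on h.isOpen hs
    (fun u hu => h.inner_tangent_tangent hu)
  have h3 := h1.unique h2
  rw [inner_smul_left, inner_smul_right, real_inner_comm] at h3
  have h4 := (h.curvature_pos s hs).ne'
  simp only [conj_trivial] at h3
  rcases mul_eq_zero.1 (show curvature x s * inner ℝ (tangent x s) (normal x s) = 0 by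
    rw [real_inner_comm]; linarith) with h5 | h5
  · exact absurd h5 h4
  · exact h5

theorem inner_binormal_binormal {s : ℝ} (hs : s ∈ I) :
    inner ℝ (binormal x s) (binormal x s) = (1 : ℝ) := by
  rw [binormal, inner_cross_cross_self, h.inner_tangent_tangent hs, h.inner_normal_normal hs,
    h.inner_tangent_normal hs]
  norm_num

theorem eq_frame {s : ℝ} (hs : s ∈ I) (w : E3) :
    w = (inner ℝ (tangent x s) w : ℝ) • tangent x s + (inner ℝ (normal x s) w : ℝ) • normal x s
      + (inner ℝ (binormal x s) w : ℝ) • binormal x s :=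
  eq_sum_inner_smul_of_orthonormal (h.inner_tangent_tangent hs) (h.inner_normal_normal hs)
    (h.inner_tangent_normal hs) w

/-- The tangential and normal components come from differentiating ⟨t, n⟩ = 0 and ⟨n, n⟩ = 1; the
binormal one is the torsion by definition. -/
theorem hasDerivAt_normal {s : ℝ} (hs : s ∈ I) :
    HasDerivAt (normal x) (-curvature x s • tangent x s + torsion x s • binormal x s) s := by
  have hd := h.contDiffOn_normal.hasDerivAt_of_isOpen h.isOpen hs
  refine hd.congr_deriv ?_
  have h1 := ((h.hasDerivAt_tangent hs).inner ℝ hd).unique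
    ((hasDerivAt_const s (0 : ℝ)).congr_on h.isOpen hs (fun u hu => h.inner_tangent_normal hu))
  have h2 := (hd.inner ℝ hd).unique
    ((hasDerivAt_const s (1 : ℝ)).congr_on h.isOpen hs (fun u hu => h.inner_normal_normal hu))
  rw [inner_smul_left, h.inner_normal_normal hs] at h1
  rw [real_inner_comm (deriv (normal x) s)] at h2
  simp only [conj_trivial] at h1
  have e1 : inner ℝ (tangent x s) (deriv (normal x) s) = -curvature x s := by linarith
  have e2 : inner ℝ (normal x s) (deriv (normal x) s) = (0 : ℝ) := by
    rw [real_inner_comm]; linarith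
  have e3 : inner ℝ (binormal x s) (deriv (normal x) s) = torsion x s := by
    rw [real_inner_comm, torsion]
  rw [h.eq_frame hs (deriv (normal x) s), e1, e2, e3]
  module

theorem hasDerivAt_binormal {s : ℝ} (hs : s ∈ I) :
    HasDerivAt (binormal x) (-torsion x s • normal x s) s := by
  have hd := h.contDiffOn_binormal.hasDerivAt_of_isOpen h.isOpen hs
  refine hd.congr_deriv ?_
  have h1 := ((h.hasDerivAt_tangent hs).inner ℝ hd).unique
    ((hasDerivAt_const s (0 : ℝ)).congr_on h.isOpen hs (fun u _ => inner_tangent_binormal x u))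
  have h2 := ((h.hasDerivAt_normal hs).inner ℝ hd).unique
    ((hasDerivAt_const s (0 : ℝ)).congr_on h.isOpen hs (fun u _ => inner_normal_binormal x u))
  have h3 := (hd.inner ℝ hd).unique
    ((hasDerivAt_const s (1 : ℝ)).congr_on h.isOpen hs (fun u hu => h.inner_binormal_binormal hu))
  rw [inner_smul_left, inner_normal_binormal] at h1
  rw [inner_add_left, inner_smul_left, inner_smul_left, inner_tangent_binormal,
    h.inner_binormal_binormal hs] at h2
  rw [real_inner_comm (deriv (binormal x) s)] at h3
  simp only [conj_trivial] at h1 h2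
  have e1 : inner ℝ (tangent x s) (deriv (binormal x) s) = (0 : ℝ) := by linarith
  have e2 : inner ℝ (normal x s) (deriv (binormal x) s) = -torsion x s := by linarith
  have e3 : inner ℝ (binormal x s) (deriv (binormal x) s) = (0 : ℝ) := by
    rw [real_inner_comm]; linarith
  rw [h.eq_frame hs (deriv (binormal x) s), e1, e2, e3]
  module

theorem hasDerivAt_curvature {s : ℝ} (hs : s ∈ I) :
    HasDerivAt (curvature x) (deriv (curvature x) s) s :=
  h.contDiffOn_curvature.hasDerivAt_of_isOpen h.isOpen hs

theorem hasDerivAt_deriv_curvature {s : ℝ} (hs : s ∈ I) :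
    HasDerivAt (deriv (curvature x)) (deriv (deriv (curvature x)) s) s :=
  (h.contDiffOn_curvature.deriv_infty h.isOpen).hasDerivAt_of_isOpen h.isOpen hs

theorem hasDerivAt_torsion {s : ℝ} (hs : s ∈ I) :
    HasDerivAt (torsion x) (deriv (torsion x) s) s :=
  h.contDiffOn_torsion.hasDerivAt_of_isOpen h.isOpen hs

end IsVertexFree

/-- The first derivatives of a curve in terms of its Frenet frame. -/
noncomputable def frenetDeriv (x : ℝ → E3) : ℕ → ℝ → E3
  | 0 => x
  | 1 => tangent x
  | 2 => fun s => curvature x s • normal x s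
  | 3 => fun s => -curvature x s ^ 2 • tangent x s + deriv (curvature x) s • normal x s
      + (curvature x s * torsion x s) • binormal x s
  | 4 => fun s => (-3 * curvature x s * deriv (curvature x) s) • tangent x s
      + (deriv (deriv (curvature x)) s - curvature x s ^ 3
        - curvature x s * torsion x s ^ 2) • normal x s
      + (2 * deriv (curvature x) s * torsion x s
        + curvature x s * deriv (torsion x) s) • binormal x s
  | _ => 0

theorem IsVertexFree.hasDerivAt_frenetDeriv (h : IsVertexFree I x) {s : ℝ} (hs : s ∈ I) {k : ℕ}
    (hk : k < 4) : HasDerivAt (frenetDeriv x k) (frenetDeriv x (k + 1) s) s := by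
  have ht := h.hasDerivAt_tangent hs
  have hn := h.hasDerivAt_normal hs
  have hb := h.hasDerivAt_binormal hs
  have hκ := h.hasDerivAt_curvature hs
  have hκ' := h.hasDerivAt_deriv_curvature hs
  have hτ := h.hasDerivAt_torsion hs
  interval_cases k
  · exact h.contDiffOn.hasDerivAt_of_isOpen h.isOpen hs
  · exact ht
  · refine (hκ.fun_smul hn).congr_deriv ?_
    simp only [frenetDeriv, Nat.reduceAdd]
    module
  · refine ((((hκ.fun_pow 2).fun_neg).fun_smul ht).fun_add (hκ'.fun_smul hn)).fun_add
      ((hκ.fun_mul hτ).fun_smul hb) |>.congr_deriv ?_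
    simp only [frenetDeriv, Nat.reduceAdd, Nat.cast_ofNat, Nat.reduceSub, pow_one]
    module

end Frenet

/-! ### The lift to the light cone and its derivatives -/

section Lift

/-- The model `ℝ³ × ℝ × ℝ` of Minkowski space `ℝ^{4,1}`. -/
abbrev Minkowski : Type := E3 × ℝ × ℝ

/-- The Lorentzian form `⟨x, y⟩ - a d - b c` of `(x, a, b)` and `(y, c, d)`. -/
noncomputable def lorentz : Minkowski →L[ℝ] Minkowski →L[ℝ] ℝ :=
  (isBoundedBilinearMap_inner (𝕜 := ℝ) (E := E3)).toContinuousLinearMap.bilinearComp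
      (ContinuousLinearMap.fst ℝ E3 (ℝ × ℝ))
      (ContinuousLinearMap.fst ℝ E3 (ℝ × ℝ))
    - (ContinuousLinearMap.mul ℝ ℝ).bilinearComp
      ((ContinuousLinearMap.fst ℝ ℝ ℝ).comp (ContinuousLinearMap.snd ℝ E3 (ℝ × ℝ)))
      ((ContinuousLinearMap.snd ℝ ℝ ℝ).comp (ContinuousLinearMap.snd ℝ E3 (ℝ × ℝ)))
    - (ContinuousLinearMap.mul ℝ ℝ).bilinearComp
      ((ContinuousLinearMap.snd ℝ ℝ ℝ).comp (ContinuousLinearMap.snd ℝ E3 (ℝ × ℝ)))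
      ((ContinuousLinearMap.fst ℝ ℝ ℝ).comp (ContinuousLinearMap.snd ℝ E3 (ℝ × ℝ)))

theorem lorentz_apply (u v : Minkowski) :
    lorentz u v = inner ℝ u.1 v.1 - u.2.1 * v.2.2 - u.2.2 * v.2.1 := by
  simp [lorentz]

theorem lorentz_comm (u v : Minkowski) : lorentz u v = lorentz v u := by
  rw [lorentz_apply, lorentz_apply, real_inner_comm]
  ring

theorem _root_.HasDerivAt.lorentz {f g : ℝ → Minkowski} {f' g' : Minkowski} {s : ℝ}
    (hf : HasDerivAt f f' s) (hg : HasDerivAt g g' s) :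
    HasDerivAt (fun s => lorentz (f s) (g s)) (lorentz f' (g s) + lorentz (f s) g') s :=
  (ConformalCurve.lorentz.hasFDerivAt.comp_hasDerivAt s hf).clm_apply hg

/-- The lift of a point of Euclidean space to the light cone. -/
noncomputable def lightLift (p : E3) : Minkowski := (p, 1, ‖p‖ ^ 2 / 2)

/-- Squared distances become bilinear in the lifted points, so rescaling a lift multiplies all its
distances by one factor. -/
theorem lorentz_lightLift (p r : E3) : -2 * lorentz (lightLift p) (lightLift r) = ‖p - r‖ ^ 2 := by
  rw [lorentz_apply, norm_sub_sq_real]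
  simp only [lightLift]
  ring

/-- The derivatives of the lift of a curve to the light cone. -/
noncomputable def liftDeriv (x : ℝ → E3) (k : ℕ) (s : ℝ) : Minkowski :=
  (frenetDeriv x k s, if k = 0 then 1 else 0, iteratedDeriv k (fun s => ‖x s‖ ^ 2 / 2) s)

theorem liftDeriv_zero (x : ℝ → E3) (s : ℝ) : liftDeriv x 0 s = lightLift (x s) := by
  simp [liftDeriv, lightLift, frenetDeriv]

theorem _root_.ContDiffOn.iteratedDeriv_infty {f : ℝ → ℝ} {I : Set ℝ} (hI : IsOpen I)
    (hf : ContDiffOn ℝ ∞ f I) (k : ℕ) : ContDiffOn ℝ ∞ (iteratedDeriv k f) I := by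
  induction k with
  | zero => simpa using hf
  | succ k ih => rw [iteratedDeriv_succ]; exact ih.deriv_infty hI

variable {I : Set ℝ} {x : ℝ → E3}

namespace IsVertexFree

variable (h : IsVertexFree I x)
include h

theorem hasDerivAt_liftDeriv {s : ℝ} (hs : s ∈ I) {k : ℕ} (hk : k < 4) :
    HasDerivAt (liftDeriv x k) (liftDeriv x (k + 1) s) s := by
  have hy : ContDiffOn ℝ ∞ (fun s => ‖x s‖ ^ 2 / 2) I := (h.contDiffOn.norm_sq ℝ).div_const 2
  refine (h.hasDerivAt_frenetDeriv hs hk).prodMk (HasDerivAt.prodMk ?_ ?_)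
  · simpa using hasDerivAt_const s _
  · rw [iteratedDeriv_succ]
    exact (hy.iteratedDeriv_infty h.isOpen k).hasDerivAt_of_isOpen h.isOpen hs

theorem contDiffOn_lightLift : ContDiffOn ℝ ∞ (fun s => lightLift (x s)) I :=
  h.contDiffOn.prodMk (contDiffOn_const.prodMk ((h.contDiffOn.norm_sq ℝ).div_const 2))

omit h in
-- The constant coordinate 1 has derivative 0 and is paired with the quadratic coordinate, so only
-- the Euclidean part contributes.
theorem _root_.ConformalCurve.lorentz_liftDeriv_succ (k l : ℕ) (s : ℝ) :
    lorentz (liftDeriv x (k + 1) s) (liftDeriv x (l + 1) s)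
      = inner ℝ (frenetDeriv x (k + 1) s) (frenetDeriv x (l + 1) s) := by
  simp [lorentz_apply, liftDeriv]

theorem lorentz_liftDeriv {s : ℝ} (hs : s ∈ I) :
    (lorentz (liftDeriv x 1 s) (liftDeriv x 1 s) = 1 ∧
    lorentz (liftDeriv x 1 s) (liftDeriv x 2 s) = 0 ∧
    lorentz (liftDeriv x 1 s) (liftDeriv x 3 s) = -curvature x s ^ 2 ∧
    lorentz (liftDeriv x 1 s) (liftDeriv x 4 s) = -3 * curvature x s * deriv (curvature x) s) ∧
    (lorentz (liftDeriv x 2 s) (liftDeriv x 2 s) = curvature x s ^ 2 ∧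
    lorentz (liftDeriv x 2 s) (liftDeriv x 3 s) = curvature x s * deriv (curvature x) s ∧
    lorentz (liftDeriv x 2 s) (liftDeriv x 4 s) = curvature x s * (deriv (deriv (curvature x)) s
      - curvature x s ^ 3 - curvature x s * torsion x s ^ 2)) ∧
    (lorentz (liftDeriv x 3 s) (liftDeriv x 3 s) = curvature x s ^ 4 + deriv (curvature x) s ^ 2
      + curvature x s ^ 2 * torsion x s ^ 2 ∧
    lorentz (liftDeriv x 3 s) (liftDeriv x 4 s) = 3 * curvature x s ^ 3 * deriv (curvature x) s
      + deriv (curvature x) s * (deriv (deriv (curvature x)) s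
        - curvature x s ^ 3 - curvature x s * torsion x s ^ 2)
      + curvature x s * torsion x s * (2 * deriv (curvature x) s * torsion x s
        + curvature x s * deriv (torsion x) s)) ∧
    lorentz (liftDeriv x 4 s) (liftDeriv x 4 s) = 9 * curvature x s ^ 2 * deriv (curvature x) s ^ 2
      + (deriv (deriv (curvature x)) s
        - curvature x s ^ 3 - curvature x s * torsion x s ^ 2) ^ 2
      + (2 * deriv (curvature x) s * torsion x s + curvature x s * deriv (torsion x) s) ^ 2 := by
  have htt := h.inner_tangent_tangent hs
  have hnn := h.inner_normal_normal hs
  have hbb := h.inner_binormal_binormal hs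
  have htn := h.inner_tangent_normal hs
  have htb := inner_tangent_binormal x s
  have hnb := inner_normal_binormal x s
  have hnt := real_inner_comm (tangent x s) (normal x s)
  have hbt := real_inner_comm (tangent x s) (binormal x s)
  have hbn := real_inner_comm (normal x s) (binormal x s)
  rw [htn] at hnt
  rw [htb] at hbt
  rw [hnb] at hbn
  have e := fun k l => lorentz_liftDeriv_succ (x := x) k l s
  refine ⟨⟨(e 0 0).trans ?_, (e 0 1).trans ?_, (e 0 2).trans ?_, (e 0 3).trans ?_⟩,
    ⟨(e 1 1).trans ?_, (e 1 2).trans ?_, (e 1 3).trans ?_⟩,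
    ⟨(e 2 2).trans ?_, (e 2 3).trans ?_⟩, (e 3 3).trans ?_⟩ <;>
  · simp only [frenetDeriv, Nat.reduceAdd, inner_add_left, inner_add_right, inner_smul_left,
      inner_smul_right, htt, hnn, hbb, htn, htb, hnb, hnt, hbt, hbn, conj_trivial]
    try ring

theorem lorentz_liftDeriv_add {k l : ℕ} (hk : k < 4) (hl : l < 4) {c : ℝ}
    (hc : ∀ s ∈ I, lorentz (liftDeriv x k s) (liftDeriv x l s) = c) {s : ℝ} (hs : s ∈ I) :
    lorentz (liftDeriv x (k + 1) s) (liftDeriv x l s)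
      + lorentz (liftDeriv x k s) (liftDeriv x (l + 1) s) = 0 :=
  ((h.hasDerivAt_liftDeriv hs hk).lorentz (h.hasDerivAt_liftDeriv hs hl)).unique
    ((hasDerivAt_const s c).congr_on h.isOpen hs hc)

omit h in
theorem _root_.ConformalCurve.lorentz_liftDeriv_zero_zero (x : ℝ → E3) (s : ℝ) :
    lorentz (liftDeriv x 0 s) (liftDeriv x 0 s) = 0 := by
  have := lorentz_lightLift (x s) (x s)
  rw [liftDeriv_zero]
  simpa using this

/-- The products with the lift itself would involve derivatives of |x|²/2. Differentiating the
preceding relation, here and for the higher orders, avoids computing them. -/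
theorem lorentz_liftDeriv_zero_one {s : ℝ} (hs : s ∈ I) :
    lorentz (liftDeriv x 0 s) (liftDeriv x 1 s) = 0 := by
  have := h.lorentz_liftDeriv_add (k := 0) (l := 0) (by norm_num) (by norm_num)
    (fun s _ => lorentz_liftDeriv_zero_zero x s) hs
  have := lorentz_comm (liftDeriv x 0 s) (liftDeriv x 1 s)
  norm_num at *
  linarith

theorem lorentz_liftDeriv_zero_two {s : ℝ} (hs : s ∈ I) :
    lorentz (liftDeriv x 0 s) (liftDeriv x 2 s) = -1 := by
  have := h.lorentz_liftDeriv_add (k := 0) (l := 1) (by norm_num) (by norm_num)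
    (fun s hs => h.lorentz_liftDeriv_zero_one hs) hs
  have := (h.lorentz_liftDeriv hs).1.1
  norm_num at *
  linarith

theorem lorentz_liftDeriv_zero_three {s : ℝ} (hs : s ∈ I) :
    lorentz (liftDeriv x 0 s) (liftDeriv x 3 s) = 0 := by
  have := h.lorentz_liftDeriv_add (k := 0) (l := 2) (by norm_num) (by norm_num)
    (fun s hs => h.lorentz_liftDeriv_zero_two hs) hs
  have := (h.lorentz_liftDeriv hs).1.2.1
  norm_num at *
  linarith

theorem lorentz_liftDeriv_zero_four {s : ℝ} (hs : s ∈ I) :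
    lorentz (liftDeriv x 0 s) (liftDeriv x 4 s) = curvature x s ^ 2 := by
  have := h.lorentz_liftDeriv_add (k := 0) (l := 3) (by norm_num) (by norm_num)
    (fun s hs => h.lorentz_liftDeriv_zero_three hs) hs
  have := (h.lorentz_liftDeriv hs).1.2.2.1
  norm_num at *
  linarith

end IsVertexFree

/-- The density `√ν` of the conformal length with respect to arc length. -/
noncomputable def conformalDensity (x : ℝ → E3) (s : ℝ) : ℝ :=
  √(nu (curvature x) (torsion x) s)

/-- The logarithmic derivative of the density of the conformal length. -/
noncomputable def logDensityDeriv (x : ℝ → E3) (s : ℝ) : ℝ :=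
  deriv (conformalDensity x) s / conformalDensity x s

/-- The successive derivatives `φ⁻¹ • d/ds` of `f`. -/
noncomputable def densityDeriv {F : Type*} [NormedAddCommGroup F] [NormedSpace ℝ F] (φ : ℝ → ℝ)
    (f : ℝ → F) : ℕ → ℝ → F
  | 0 => f
  | k + 1 => fun s => (φ s)⁻¹ • deriv (densityDeriv φ f k) s

/-- The successive derivatives, with respect to conformal length, of the lift `√ν • (x, 1, |x|²/2)`
of the curve to the light cone. -/
noncomputable def conformalLift (x : ℝ → E3) : ℕ → ℝ → Minkowski :=
  densityDeriv (conformalDensity x) fun s => conformalDensity x s • lightLift (x s)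

theorem conformalLift_zero (x : ℝ → E3) (s : ℝ) :
    conformalLift x 0 s = conformalDensity x s • liftDeriv x 0 s := by
  rw [liftDeriv_zero, conformalLift, densityDeriv]

/-- The Gram numbers of the derivatives of the conformal lift. -/
noncomputable def conformalGram (x : ℝ → E3) (k l : ℕ) (s : ℝ) : ℝ :=
  lorentz (conformalLift x k s) (conformalLift x l s)

/-- The successive derivatives, with respect to conformal length, of the Gram number of order
`(2, 2)`. -/
noncomputable def conformalGramDeriv (x : ℝ → E3) : ℕ → ℝ → ℝ :=
  densityDeriv (conformalDensity x) (conformalGram x 2 2)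

namespace IsVertexFree

variable (h : IsVertexFree I x)
include h

theorem conformalDensity_pos {s : ℝ} (hs : s ∈ I) : 0 < conformalDensity x s :=
  Real.sqrt_pos.2 (h.nu_pos s hs)

theorem conformalDensity_sq {s : ℝ} (hs : s ∈ I) :
    conformalDensity x s ^ 2 = nu (curvature x) (torsion x) s :=
  Real.sq_sqrt (h.nu_pos s hs).le

theorem contDiffOn_conformalDensity : ContDiffOn ℝ ∞ (conformalDensity x) I :=
  h.contDiffOn_nu.sqrt fun s hs => (h.nu_pos s hs).ne'

theorem contDiffOn_logDensityDeriv : ContDiffOn ℝ ∞ (logDensityDeriv x) I :=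
  (h.contDiffOn_conformalDensity.deriv_infty h.isOpen).div h.contDiffOn_conformalDensity
    fun _ hs => (h.conformalDensity_pos hs).ne'

theorem hasDerivAt_conformalDensity {s : ℝ} (hs : s ∈ I) :
    HasDerivAt (conformalDensity x) (logDensityDeriv x s * conformalDensity x s) s := by
  have := (h.conformalDensity_pos hs).ne'
  rw [logDensityDeriv, div_mul_cancel₀ _ this]
  exact h.contDiffOn_conformalDensity.hasDerivAt_of_isOpen h.isOpen hs

theorem hasDerivAt_inv_conformalDensity {s : ℝ} (hs : s ∈ I) :
    HasDerivAt (fun s => (conformalDensity x s)⁻¹)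
      (-logDensityDeriv x s * (conformalDensity x s)⁻¹) s := by
  have := (h.conformalDensity_pos hs).ne'
  refine ((h.hasDerivAt_conformalDensity hs).fun_inv this).congr_deriv ?_
  field_simp

theorem contDiffOn_densityDeriv {F : Type*} [NormedAddCommGroup F] [NormedSpace ℝ F] {f : ℝ → F}
    (hf : ContDiffOn ℝ ∞ f I) (k : ℕ) :
    ContDiffOn ℝ ∞ (densityDeriv (conformalDensity x) f k) I := by
  induction k with
  | zero => exact hf
  | succ k ih =>
    exact (h.contDiffOn_conformalDensity.inv fun _ hs => (h.conformalDensity_pos hs).ne').smul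
      (ih.deriv_infty h.isOpen)

theorem hasDerivAt_densityDeriv {F : Type*} [NormedAddCommGroup F] [NormedSpace ℝ F] {f : ℝ → F}
    (hf : ContDiffOn ℝ ∞ f I) (k : ℕ) {s : ℝ} (hs : s ∈ I) :
    HasDerivAt (densityDeriv (conformalDensity x) f k)
      (conformalDensity x s • densityDeriv (conformalDensity x) f (k + 1) s) s := by
  have := (h.contDiffOn_densityDeriv hf k).hasDerivAt_of_isOpen h.isOpen hs
  rwa [densityDeriv, smul_inv_smul₀ (h.conformalDensity_pos hs).ne']

theorem densityDeriv_succ_eq {F : Type*} [NormedAddCommGroup F] [NormedSpace ℝ F] {f g : ℝ → F}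
    {k : ℕ} {g' : F} {s : ℝ} (hs : s ∈ I)
    (hg : ∀ s ∈ I, densityDeriv (conformalDensity x) f k s = g s) (hg' : HasDerivAt g g' s) :
    densityDeriv (conformalDensity x) f (k + 1) s = (conformalDensity x s)⁻¹ • g' := by
  simp only [densityDeriv, (hg'.congr_on h.isOpen hs hg).deriv]

theorem contDiffOn_smul_lightLift :
    ContDiffOn ℝ ∞ (fun s => conformalDensity x s • lightLift (x s)) I :=
  h.contDiffOn_conformalDensity.smul h.contDiffOn_lightLift

theorem hasDerivAt_conformalLift (k : ℕ) {s : ℝ} (hs : s ∈ I) :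
    HasDerivAt (conformalLift x k) (conformalDensity x s • conformalLift x (k + 1) s) s :=
  h.hasDerivAt_densityDeriv h.contDiffOn_smul_lightLift k hs

theorem hasDerivAt_conformalGram (k l : ℕ) {s : ℝ} (hs : s ∈ I) :
    HasDerivAt (conformalGram x k l) (conformalDensity x s *
      (conformalGram x (k + 1) l s + conformalGram x k (l + 1) s)) s := by
  refine ((h.hasDerivAt_conformalLift k hs).lorentz
    (h.hasDerivAt_conformalLift l hs)).congr_deriv ?_
  simp only [map_smul, smul_apply, smul_eq_mul, conformalGram]
  ring

theorem hasDerivAt_conformalGramDeriv (k : ℕ) {s : ℝ} (hs : s ∈ I) :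
    HasDerivAt (conformalGramDeriv x k)
      (conformalDensity x s * conformalGramDeriv x (k + 1) s) s := by
  have h2 : ContDiffOn ℝ ∞ (conformalLift x 2) I :=
    h.contDiffOn_densityDeriv h.contDiffOn_smul_lightLift 2
  exact h.hasDerivAt_densityDeriv ((lorentz.contDiff.comp_contDiffOn h2).clm_apply h2) k hs

/-- With φ = √ν and θ = φ'/φ, the operator φ⁻¹ d/ds lets the powers of φ factor out: the k-th
derivative is φ^(1-k) times a combination with coefficients polynomial in θ, θ', …. -/
theorem conformalLift_one {s : ℝ} (hs : s ∈ I) :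
    conformalLift x 1 s = logDensityDeriv x s • liftDeriv x 0 s + liftDeriv x 1 s := by
  rw [conformalLift, h.densityDeriv_succ_eq hs (fun s _ => conformalLift_zero x s)
    ((h.hasDerivAt_conformalDensity hs).fun_smul (h.hasDerivAt_liftDeriv hs (by norm_num : 0 < 4)))]
  have := (h.conformalDensity_pos hs).ne'
  match_scalars <;> field_simp

theorem hasDerivAt_logDensityDeriv {s : ℝ} (hs : s ∈ I) :
    HasDerivAt (logDensityDeriv x) (deriv (logDensityDeriv x) s) s :=
  h.contDiffOn_logDensityDeriv.hasDerivAt_of_isOpen h.isOpen hs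

theorem hasDerivAt_deriv_logDensityDeriv {s : ℝ} (hs : s ∈ I) :
    HasDerivAt (deriv (logDensityDeriv x)) (deriv (deriv (logDensityDeriv x)) s) s :=
  (h.contDiffOn_logDensityDeriv.deriv_infty h.isOpen).hasDerivAt_of_isOpen h.isOpen hs

theorem hasDerivAt_deriv_deriv_logDensityDeriv {s : ℝ} (hs : s ∈ I) :
    HasDerivAt (deriv (deriv (logDensityDeriv x)))
      (deriv (deriv (deriv (logDensityDeriv x))) s) s :=
  ((h.contDiffOn_logDensityDeriv.deriv_infty h.isOpen).deriv_infty h.isOpen).hasDerivAt_of_isOpen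
    h.isOpen hs

theorem conformalLift_two {s : ℝ} (hs : s ∈ I) :
    conformalLift x 2 s = (conformalDensity x s)⁻¹ • (deriv (logDensityDeriv x) s • liftDeriv x 0 s
      + logDensityDeriv x s • liftDeriv x 1 s + liftDeriv x 2 s) := by
  rw [conformalLift, h.densityDeriv_succ_eq hs (fun s hs => h.conformalLift_one hs)
    (((h.hasDerivAt_logDensityDeriv hs).fun_smul
      (h.hasDerivAt_liftDeriv hs (by norm_num : 0 < 4))).fun_add
      (h.hasDerivAt_liftDeriv hs (by norm_num : 1 < 4)))]
  module

theorem conformalLift_three {s : ℝ} (hs : s ∈ I) :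
    conformalLift x 3 s = (conformalDensity x s)⁻¹ ^ 2 •
      ((deriv (deriv (logDensityDeriv x)) s - logDensityDeriv x s * deriv (logDensityDeriv x) s)
          • liftDeriv x 0 s
        + (2 * deriv (logDensityDeriv x) s - logDensityDeriv x s ^ 2) • liftDeriv x 1 s
        + liftDeriv x 3 s) := by
  rw [conformalLift, h.densityDeriv_succ_eq hs (fun s hs => h.conformalLift_two hs)
    ((h.hasDerivAt_inv_conformalDensity hs).fun_smul
      ((((h.hasDerivAt_deriv_logDensityDeriv hs).fun_smul
      (h.hasDerivAt_liftDeriv hs (by norm_num : 0 < 4))).fun_add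
      ((h.hasDerivAt_logDensityDeriv hs).fun_smul
      (h.hasDerivAt_liftDeriv hs (by norm_num : 1 < 4)))).fun_add
      (h.hasDerivAt_liftDeriv hs (by norm_num : 2 < 4))))]
  module

/-- The first two coefficients may stay anonymous, since the torsion is read off modulo the span of
the lift and its first derivative. -/
theorem conformalLift_four {s : ℝ} (hs : s ∈ I) :
    ∃ E F : ℝ, conformalLift x 4 s = (conformalDensity x s)⁻¹ ^ 3 •
      (E • liftDeriv x 0 s + F • liftDeriv x 1 s
        + (2 * deriv (logDensityDeriv x) s - logDensityDeriv x s ^ 2) • liftDeriv x 2 s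
        + (-2 * logDensityDeriv x s) • liftDeriv x 3 s
        + liftDeriv x 4 s) := by
  have hθ := h.hasDerivAt_logDensityDeriv hs
  have hθ' := h.hasDerivAt_deriv_logDensityDeriv hs
  have hθ'' := h.hasDerivAt_deriv_deriv_logDensityDeriv hs
  have key := h.densityDeriv_succ_eq hs (fun s hs => h.conformalLift_three hs)
    (((h.hasDerivAt_inv_conformalDensity hs).fun_pow 2).fun_smul
      ((((hθ''.fun_sub (hθ.fun_mul hθ')).fun_smul
      (h.hasDerivAt_liftDeriv hs (by norm_num : 0 < 4))).fun_add
      (((hθ'.const_mul 2).fun_sub (hθ.fun_pow 2)).fun_smul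
      (h.hasDerivAt_liftDeriv hs (by norm_num : 1 < 4)))).fun_add
      (h.hasDerivAt_liftDeriv hs (by norm_num : 3 < 4))))
  norm_num at key
  set θ := logDensityDeriv x s
  set θ₁ := deriv (logDensityDeriv x) s
  set θ₂ := deriv (deriv (logDensityDeriv x)) s
  set θ₃ := deriv (deriv (deriv (logDensityDeriv x))) s
  refine ⟨θ₃ - (θ₁ * θ₁ + θ * θ₂) - 2 * θ * (θ₂ - θ * θ₁),
    (θ₂ - θ * θ₁) + (2 * θ₂ - 2 * θ * θ₁) - 2 * θ * (2 * θ₁ - θ ^ 2), ?_⟩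
  rw [conformalLift, key]
  match_scalars <;> field_simp <;> ring

end IsVertexFree

end Lift

/-! ### Conformal curvature and torsion as Gram numbers -/

section GramNumbers

variable {I : Set ℝ} {x : ℝ → E3}

namespace IsVertexFree

variable (h : IsVertexFree I x)
include h

theorem hasDerivAt_nu {s : ℝ} (hs : s ∈ I) :
    HasDerivAt (nu (curvature x) (torsion x))
      (2 * logDensityDeriv x s * nu (curvature x) (torsion x) s) s := by
  refine (((h.hasDerivAt_conformalDensity hs).fun_pow 2).congr_on h.isOpen hs
    fun u hu => (h.conformalDensity_sq hu).symm).congr_deriv ?_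
  rw [← h.conformalDensity_sq hs]
  norm_num
  ring

/-- Half the derivative of ν² = κ'² + κ²τ², using ν' = 2θν. It allows θ to be eliminated by
polynomial identities. -/
theorem two_mul_logDensityDeriv_mul {s : ℝ} (hs : s ∈ I) :
    2 * logDensityDeriv x s * nu (curvature x) (torsion x) s ^ 2
      = deriv (curvature x) s * deriv (deriv (curvature x)) s
        + curvature x s * deriv (curvature x) s * torsion x s ^ 2
        + curvature x s ^ 2 * torsion x s * deriv (torsion x) s := by
  have h1 := (h.hasDerivAt_nu hs).fun_pow 2
  have h2 := (((h.hasDerivAt_deriv_curvature hs).fun_pow 2).fun_add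
    (((h.hasDerivAt_curvature hs).fun_pow 2).fun_mul
      ((h.hasDerivAt_torsion hs).fun_pow 2))).congr_on h.isOpen hs
    (fun u _ => nu_sq (curvature x) (torsion x) u)
  have h3 := h1.unique h2
  norm_num at h3
  linear_combination h3 / 2

theorem deriv_logDensityDeriv_mul {s : ℝ} (hs : s ∈ I) :
    2 * deriv (logDensityDeriv x) s * nu (curvature x) (torsion x) s ^ 2
        + 8 * logDensityDeriv x s ^ 2 * nu (curvature x) (torsion x) s ^ 2
      = deriv (deriv (curvature x)) s ^ 2
        + deriv (curvature x) s * deriv (deriv (deriv (curvature x))) s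
        + deriv (curvature x) s ^ 2 * torsion x s ^ 2
        + curvature x s * deriv (deriv (curvature x)) s * torsion x s ^ 2
        + 4 * curvature x s * deriv (curvature x) s * torsion x s * deriv (torsion x) s
        + curvature x s ^ 2 * deriv (torsion x) s ^ 2
        + curvature x s ^ 2 * torsion x s * deriv (deriv (torsion x)) s := by
  have hκ := h.hasDerivAt_curvature hs
  have hκ' := h.hasDerivAt_deriv_curvature hs
  have hκ'' := ((h.contDiffOn_curvature.deriv_infty h.isOpen).deriv_infty
    h.isOpen).hasDerivAt_of_isOpen h.isOpen hs
  have hτ := h.hasDerivAt_torsion hs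
  have hτ' := (h.contDiffOn_torsion.deriv_infty h.isOpen).hasDerivAt_of_isOpen h.isOpen hs
  have h1 := ((h.hasDerivAt_logDensityDeriv hs).const_mul 2).fun_mul
    ((h.hasDerivAt_nu hs).fun_pow 2)
  have h2 := (((hκ'.fun_mul hκ'').fun_add ((hκ.fun_mul hκ').fun_mul (hτ.fun_pow 2))).fun_add
    (((hκ.fun_pow 2).fun_mul hτ).fun_mul hτ')).congr_on h.isOpen hs
    (fun u hu => h.two_mul_logDensityDeriv_mul hu)
  have h3 := h1.unique h2
  norm_num at h3
  linear_combination h3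

theorem conformalCurvature_eq {s : ℝ} (hs : s ∈ I) :
    conformalCurvature (curvature x) (torsion x) s
      = -(curvature x s ^ 2 + logDensityDeriv x s ^ 2 - 2 * deriv (logDensityDeriv x) s)
        / (2 * nu (curvature x) (torsion x) s) := by
  have h1 := (h.hasDerivAt_nu hs).deriv
  have h2 := ((((h.hasDerivAt_logDensityDeriv hs).const_mul 2).fun_mul
    (h.hasDerivAt_nu hs)).congr_on h.isOpen hs fun u hu => (h.hasDerivAt_nu hu).deriv).deriv
  have hν := (h.nu_pos s hs).ne'
  rw [conformalCurvature]
  simp only [iteratedDeriv_succ, iteratedDeriv_zero]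
  rw [h1, h2]
  field_simp
  ring

/-- Squaring removes the half-integer power of ν; only T² is ever needed. -/
theorem conformalTorsion_sq {s : ℝ} (hs : s ∈ I) :
    conformalTorsion (curvature x) (torsion x) s ^ 2
      = (2 * deriv (curvature x) s ^ 2 * torsion x s + curvature x s ^ 2 * torsion x s ^ 3
        + curvature x s * deriv (curvature x) s * deriv (torsion x) s
        - curvature x s * deriv (deriv (curvature x)) s * torsion x s) ^ 2
        / nu (curvature x) (torsion x) s ^ 5 := by
  have hν := h.nu_pos s hs
  rw [conformalTorsion, div_pow, ← Real.rpow_natCast (_ ^ (5 / 2 : ℝ)) 2, ← Real.rpow_mul hν.le,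
    ← Real.rpow_natCast _ 5]
  norm_num
  simp only [iteratedDeriv_succ, iteratedDeriv_zero]

/-- The explicit sixth order coefficient in terms of the conformal curvature and torsion. -/
theorem sixthOrderCoeff_eq {s : ℝ} (hs : s ∈ I) :
    sixthOrderCoeff (curvature x) (torsion x) s
      = (conformalCurvature (curvature x) (torsion x) s
          + 3 / 4 * (conformalTorsion (curvature x) (torsion x) s) ^ 2) / 24 := by
  have hν := h.nu_pos s hs
  have hN := nu_sq (curvature x) (torsion x) s
  have hA := h.two_mul_logDensityDeriv_mul hs
  have hA' := h.deriv_logDensityDeriv_mul hs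
  have hr : (curvature x s ^ 2 * torsion x s ^ 2 + deriv (curvature x) s ^ 2) ^ (5 / 2 : ℝ)
      = nu (curvature x) (torsion x) s ^ 5 := by
    rw [add_comm, ← hN, ← Real.rpow_natCast _ 2, ← Real.rpow_mul hν.le, ← Real.rpow_natCast _ 5]
    norm_num
  rw [h.conformalCurvature_eq hs, h.conformalTorsion_sq hs, sixthOrderCoeff]
  simp only [iteratedDeriv_succ, iteratedDeriv_zero]
  rw [hr]
  generalize nu (curvature x) (torsion x) s = ν at *
  generalize logDensityDeriv x s = θ at *
  generalize deriv (logDensityDeriv x) s = θ₁ at *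
  generalize deriv (deriv (deriv (curvature x))) s = k₃ at *
  generalize deriv (deriv (curvature x)) s = k₂ at *
  generalize deriv (curvature x) s = k₁ at *
  generalize curvature x s = k at *
  generalize deriv (deriv (torsion x)) s = t₂ at *
  generalize deriv (torsion x) s = t₁ at *
  generalize torsion x s = t at *
  -- The left side is 8ν⁵Q. Since 192 P = 8Q + 6T², `hP` is this relation multiplied by ν⁵.
  have key : ν ^ 4 * (8 * θ₁ - 4 * θ ^ 2 - 4 * k ^ 2)
      = (4 * (k₂ ^ 2 + k₁ * k₃ + k₁ ^ 2 * t ^ 2 + k * k₂ * t ^ 2 + 4 * k * k₁ * t * t₁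
          + k ^ 2 * t₁ ^ 2 + k ^ 2 * t * t₂) - 4 * k ^ 2 * ν ^ 2) * ν ^ 2
        - 9 * (k₁ * k₂ + k * k₁ * t ^ 2 + k ^ 2 * t * t₁) ^ 2 := by
    rw [← hA, ← hA']
    ring
  have hP : 2 * k * t * k₁ ^ 2 * (20 * k₁ * t₁ - 19 * t * k₂)
      + 2 * k ^ 3 * t ^ 3 * (5 * k₁ * t₁ - 4 * t * k₂)
      + k₁ ^ 2 * (28 * t ^ 2 * k₁ ^ 2 - 5 * k₂ ^ 2 + 4 * k₁ * k₃)
      + k ^ 2 * (19 * t ^ 4 * k₁ ^ 2 - 4 * k₁ ^ 4 + 10 * k₁ ^ 2 * t₁ ^ 2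
        + 2 * t * k₁ * (2 * k₁ * t₂ - 15 * t₁ * k₂)
        + 2 * t ^ 2 * (5 * k₂ ^ 2 + 2 * k₁ * k₃))
      + k ^ 4 * t ^ 2 * (6 * t ^ 4 - 8 * k₁ ^ 2 - 5 * t₁ ^ 2 + 4 * t * t₂) - 4 * k ^ 6 * t ^ 4
      = ν ^ 4 * (8 * θ₁ - 4 * θ ^ 2 - 4 * k ^ 2)
        + 6 * (2 * k₁ ^ 2 * t + k ^ 2 * t ^ 3 + k * k₁ * t₁ - k * k₂ * t) ^ 2 := by
    rw [key, hN]
    ring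
  rw [hP]
  field_simp
  ring

/-- The Gram number of order `(2, 2)`. -/
theorem conformalGram_two_two {s : ℝ} (hs : s ∈ I) :
    conformalGram x 2 2 s = (conformalDensity x s)⁻¹ ^ 2 *
      (curvature x s ^ 2 + logDensityDeriv x s ^ 2 - 2 * deriv (logDensityDeriv x) s) := by
  obtain ⟨⟨x11, x12, x13, x14⟩, ⟨x22, x23, x24⟩, ⟨x33, x34⟩, x44⟩ := h.lorentz_liftDeriv hs
  have x00 := lorentz_liftDeriv_zero_zero x s
  have x01 := h.lorentz_liftDeriv_zero_one hs
  have x02 := h.lorentz_liftDeriv_zero_two hs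
  simp only [conformalGram, h.conformalLift_two hs, map_add, map_smul, add_apply, smul_apply,
    smul_eq_mul, lorentz_comm (liftDeriv x 1 s) (liftDeriv x 0 s),
    lorentz_comm (liftDeriv x 2 s) (liftDeriv x 0 s),
    lorentz_comm (liftDeriv x 2 s) (liftDeriv x 1 s), x00, x01, x02, x11, x12, x22]
  ring

theorem isGramChain : IsGramChain I (conformalDensity x) (conformalGram x)
    (conformalGramDeriv x) where
  isOpen := h.isOpen
  ne_zero s hs := (h.conformalDensity_pos hs).ne'
  symm k l s := lorentz_comm _ _
  hasDerivAt k l s hs := h.hasDerivAt_conformalGram k l hs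
  hasDerivAt_q k s hs := h.hasDerivAt_conformalGramDeriv k hs
  b00 s hs := by
    simp [conformalGram, conformalLift_zero, lorentz_liftDeriv_zero_zero]
  b11 s hs := by
    have x00 := lorentz_liftDeriv_zero_zero x s
    have x01 := h.lorentz_liftDeriv_zero_one hs
    have x11 := (h.lorentz_liftDeriv hs).1.1
    simp [conformalGram, h.conformalLift_one hs, lorentz_comm (liftDeriv x 1 s) (liftDeriv x 0 s),
      x00, x01, x11]
  b22 s hs := rfl
  b33 s hs := by
    obtain ⟨⟨x11, x12, x13, x14⟩, ⟨x22, x23, x24⟩, ⟨x33, x34⟩, x44⟩ := h.lorentz_liftDeriv hs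
    have x00 := lorentz_liftDeriv_zero_zero x s
    have x01 := h.lorentz_liftDeriv_zero_one hs
    have x03 := h.lorentz_liftDeriv_zero_three hs
    -- This is where the choice of conformal length enters: the summand 1 of the Gram number is ν²
    -- divided by the fourth power of the density.
    have hN : (conformalDensity x s ^ 2) ^ 2 = _ :=
      (congrArg (· ^ 2) (h.conformalDensity_sq hs)).trans (nu_sq (curvature x) (torsion x) s)
    have hφ := (h.conformalDensity_pos hs).ne'
    simp only [conformalGramDeriv, densityDeriv, h.conformalGram_two_two hs]
    simp only [conformalGram, h.conformalLift_three hs, map_add, map_smul, add_apply, smul_apply,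
      smul_eq_mul, lorentz_comm (liftDeriv x 1 s) (liftDeriv x 0 s),
      lorentz_comm (liftDeriv x 3 s) (liftDeriv x 0 s),
      lorentz_comm (liftDeriv x 3 s) (liftDeriv x 1 s), x00, x01, x03, x11, x13, x33]
    field_simp
    linear_combination -hN

theorem conformalGramDeriv_zero_eq {s : ℝ} (hs : s ∈ I) :
    conformalGramDeriv x 0 s = -2 * conformalCurvature (curvature x) (torsion x) s := by
  have hν := (h.nu_pos s hs).ne'
  rw [conformalGramDeriv, densityDeriv, h.conformalGram_two_two hs, h.conformalCurvature_eq hs,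
    inv_pow, h.conformalDensity_sq hs]
  field_simp

/-- The Gram number of order `(4, 4)` in terms of the conformal torsion. -/
theorem conformalGram_four_four {s : ℝ} (hs : s ∈ I) :
    conformalGram x 4 4 s = conformalTorsion (curvature x) (torsion x) s ^ 2
      + 9 / 4 * conformalGramDeriv x 1 s ^ 2 + conformalGramDeriv x 0 s ^ 3
      + 2 * conformalGramDeriv x 0 s - conformalGramDeriv x 0 s * conformalGramDeriv x 2 s := by
  obtain ⟨⟨x11, x12, x13, x14⟩, ⟨x22, x23, x24⟩, ⟨x33, x34⟩, x44⟩ := h.lorentz_liftDeriv hs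
  have x00 := lorentz_liftDeriv_zero_zero x s
  have x01 := h.lorentz_liftDeriv_zero_one hs
  have x02 := h.lorentz_liftDeriv_zero_two hs
  have x03 := h.lorentz_liftDeriv_zero_three hs
  have x04 := h.lorentz_liftDeriv_zero_four hs
  have hφ := h.conformalDensity_pos hs
  have hν := h.nu_pos s hs
  have hA := h.two_mul_logDensityDeriv_mul hs
  have hN := nu_sq (curvature x) (torsion x) s
  obtain ⟨E, F, hEF⟩ := h.conformalLift_four hs
  have b14 := h.isGramChain.b14 s hs
  have b24 := h.isGramChain.b24 s hs
  have hq0 : conformalGramDeriv x 0 s = _ := h.conformalGram_two_two hs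
  have hφν : (conformalDensity x s)⁻¹ ^ 2 = (nu (curvature x) (torsion x) s)⁻¹ := by
    rw [inv_pow, h.conformalDensity_sq hs]
  have e1 : conformalGramDeriv x 1 s = -2 / 3 * conformalGram x 1 4 s := by linarith
  have e2 : conformalGramDeriv x 2 s
      = 2 * conformalGram x 2 4 s + 2 + 2 * conformalGramDeriv x 0 s ^ 2 := by linarith
  -- The left side is the squared length of the component of y'''' orthogonal to y, y', y''.
  -- Multiples of y and y' do not affect it, so `E` and `F` drop out.
  suffices hT : conformalGram x 4 4 s - conformalGram x 1 4 s ^ 2 + conformalGramDeriv x 0 s ^ 3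
      + 2 * conformalGramDeriv x 0 s * conformalGram x 2 4 s
      = conformalTorsion (curvature x) (torsion x) s ^ 2 by
    rw [e1, e2]
    linear_combination hT
  rw [h.conformalTorsion_sq hs]
  simp only [hq0, conformalGram, hEF, h.conformalLift_one hs, h.conformalLift_two hs, map_add,
    map_smul, add_apply, smul_apply, smul_eq_mul,
    lorentz_comm (liftDeriv x 1 s) (liftDeriv x 0 s),
    lorentz_comm (liftDeriv x 2 s) (liftDeriv x 0 s),
    lorentz_comm (liftDeriv x 3 s) (liftDeriv x 0 s),
    lorentz_comm (liftDeriv x 4 s) (liftDeriv x 0 s),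
    lorentz_comm (liftDeriv x 2 s) (liftDeriv x 1 s),
    lorentz_comm (liftDeriv x 3 s) (liftDeriv x 1 s),
    lorentz_comm (liftDeriv x 4 s) (liftDeriv x 1 s),
    lorentz_comm (liftDeriv x 3 s) (liftDeriv x 2 s),
    lorentz_comm (liftDeriv x 4 s) (liftDeriv x 2 s),
    lorentz_comm (liftDeriv x 4 s) (liftDeriv x 3 s),
    x00, x01, x02, x03, x04, x11, x12, x13, x14, x22, x23, x24, x33, x34, x44]
  have hψ6 : (conformalDensity x s)⁻¹ ^ 6 = (nu (curvature x) (torsion x) s)⁻¹ ^ 3 := by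
    rw [← hφν]; ring
  generalize (conformalDensity x s)⁻¹ = ψ at *
  generalize nu (curvature x) (torsion x) s = ν at *
  generalize logDensityDeriv x s = θ at *
  generalize deriv (logDensityDeriv x) s = θ₁ at *
  generalize deriv (deriv (curvature x)) s = k₂ at *
  generalize deriv (curvature x) s = k₁ at *
  generalize curvature x s = k at *
  generalize deriv (torsion x) s = t₁ at *
  generalize torsion x s = t at *
  clear * - hA hN hψ6 hν
  -- The factor ν² is there because θ is known only through 2θν²; the right side is the square of
  -- the numerator of T.
  have key : (9 * k ^ 2 * k₁ ^ 2 + (k₂ - k ^ 3 - k * t ^ 2) ^ 2 + (2 * k₁ * t + k * t₁) ^ 2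
      + k ^ 6 - 9 * k ^ 2 * k₁ ^ 2 + 2 * k ^ 2 * (k * (k₂ - k ^ 3 - k * t ^ 2))
      + (-4 * (3 * k ^ 3 * k₁ + k₁ * (k₂ - k ^ 3 - k * t ^ 2) + k * t * (2 * k₁ * t + k * t₁))
        + 8 * k ^ 3 * k₁) * θ + 4 * θ ^ 2 * (k₁ ^ 2 + k ^ 2 * t ^ 2)) * ν ^ 2
      = (2 * k₁ ^ 2 * t + k ^ 2 * t ^ 3 + k * k₁ * t₁ - k * k₂ * t) ^ 2 := by
    linear_combination ((k₂ - k ^ 3 - k * t ^ 2) ^ 2 + (2 * k₁ * t + k * t₁) ^ 2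
      + k ^ 6 + 2 * k ^ 2 * (k * (k₂ - k ^ 3 - k * t ^ 2)) - 4 * θ ^ 2 * ν ^ 2) * hN
      + ((-4 * (3 * k ^ 3 * k₁ + k₁ * (k₂ - k ^ 3 - k * t ^ 2) + k * t * (2 * k₁ * t + k * t₁))
        + 8 * k ^ 3 * k₁) / 2 + 2 * θ * ν ^ 2
        + (k₁ * k₂ + k * k₁ * t ^ 2 + k ^ 2 * t * t₁)) * hA
  rw [← key]
  have e : ∀ r : ℝ, r * ν ^ 2 / ν ^ 5 = ψ ^ 6 * r := fun r => by
    rw [hψ6]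
    field_simp
  rw [e]
  ring

end IsVertexFree

end GramNumbers

/-! ### Inverting the conformal length -/

section ConformalLength

variable {I : Set ℝ} {x : ℝ → E3}

namespace IsVertexFree

variable (h : IsVertexFree I x)
include h

theorem hasDerivAt_conformalLength (hI : I.OrdConnected) {s₀ s : ℝ} (hs₀ : s₀ ∈ I) (hs : s ∈ I) :
    HasDerivAt (conformalLength (curvature x) (torsion x) s₀) (conformalDensity x s) s := by
  have hc := h.contDiffOn_conformalDensity.continuousOn
  exact intervalIntegral.integral_hasDerivAt_right
    ((hc.mono (hI.uIcc_subset hs₀ hs)).intervalIntegrable)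
    (hc.stronglyMeasurableAtFilter h.isOpen s hs) (hc.continuousAt (h.isOpen.mem_nhds hs))

theorem injOn_conformalLength (hI : I.OrdConnected) {s₀ : ℝ} (hs₀ : s₀ ∈ I) :
    Set.InjOn (conformalLength (curvature x) (torsion x) s₀) I := by
  refine (strictMonoOn_of_deriv_pos hI.convex (fun s hs =>
    (h.hasDerivAt_conformalLength hI hs₀ hs).continuousAt.continuousWithinAt)
    fun s hs => ?_).injOn
  have hs' := interior_subset hs
  rw [(h.hasDerivAt_conformalLength hI hs₀ hs').deriv]
  exact h.conformalDensity_pos hs'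

/-- The conformal length has a local inverse. -/
theorem exists_localInverse_conformalLength (hI : I.OrdConnected) {s₀ : ℝ} (hs₀ : s₀ ∈ I) :
    ∃ ρ : ℝ → ℝ, ρ 0 = s₀ ∧ ∀ᶠ w in 𝓝 (0 : ℝ), ρ w ∈ I ∧
      conformalLength (curvature x) (torsion x) s₀ (ρ w) = w ∧
      HasDerivAt ρ (conformalDensity x (ρ w))⁻¹ w := by
  set L := conformalLength (curvature x) (torsion x) s₀ with hL
  have h0 : L s₀ = 0 := by simp [hL, conformalLength]
  have hst : HasStrictDerivAt L (conformalDensity x s₀) s₀ :=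
    hasStrictDerivAt_of_hasDerivAt_of_continuousAt
      (Filter.eventually_of_mem (h.isOpen.mem_nhds hs₀)
        fun s hs => h.hasDerivAt_conformalLength hI hs₀ hs)
      (h.contDiffOn_conformalDensity.continuousOn.continuousAt (h.isOpen.mem_nhds hs₀))
  have hst' := hst.hasStrictFDerivAt_equiv (h.conformalDensity_pos hs₀).ne'
  set e := hst'.toOpenPartialHomeomorph L with he
  have hcoe : ∀ s, e s = L s := fun s => rfl
  have hsrc : s₀ ∈ e.source := hst'.mem_toOpenPartialHomeomorph_source
  have htgt : (0 : ℝ) ∈ e.target := by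
    have := e.map_source hsrc
    rwa [hcoe, h0] at this
  have hinv : e.symm 0 = s₀ := by
    have := e.left_inv hsrc
    rwa [hcoe, h0] at this
  refine ⟨e.symm, hinv, ?_⟩
  have hI' : ∀ᶠ w in 𝓝 (0 : ℝ), e.symm w ∈ I := by
    have hc : ContinuousAt e.symm 0 := e.continuousAt_symm htgt
    exact hc.eventually_mem (by rw [hinv]; exact h.isOpen.mem_nhds hs₀)
  filter_upwards [hI', e.open_target.mem_nhds htgt] with w hw hwt
  refine ⟨hw, e.right_inv hwt, ?_⟩
  exact e.hasDerivAt_symm hwt (h.conformalDensity_pos hw).ne'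
    (h.hasDerivAt_conformalLength hI hs₀ hw)

/-- No regularity of σ is assumed: injectivity of the conformal length on I forces σ to agree near 0
with the smooth local inverse. -/
theorem hasDerivAt_of_isConformalLengthInverse (hI : I.OrdConnected) {s₀ : ℝ} (hs₀ : s₀ ∈ I)
    {σ : ℝ → ℝ} (hσ : IsConformalLengthInverse (curvature x) (torsion x) I s₀ σ) :
    σ 0 = s₀ ∧ ∀ᶠ w in 𝓝 (0 : ℝ), σ w ∈ I ∧ HasDerivAt σ (conformalDensity x (σ w))⁻¹ w := by
  obtain ⟨ρ, hρ0, hρ⟩ := h.exists_localInverse_conformalLength hI hs₀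
  have heq : ∀ᶠ w in 𝓝 (0 : ℝ), σ w = ρ w := by
    filter_upwards [hσ, hρ] with w h1 h2
    exact h.injOn_conformalLength hI hs₀ h1.1 h2.1 (h1.2.trans h2.2.1.symm)
  refine ⟨heq.self_of_nhds.trans hρ0, ?_⟩
  filter_upwards [heq.eventually_nhds, hρ] with w h1 h2
  rw [h1.self_of_nhds]
  exact ⟨h2.1, h2.2.2.congr_of_eventuallyEq h1⟩

/-- The chain of derivatives of a function on the curve with respect to conformal length. -/
theorem eventually_hasDerivAt_densityDeriv {F : Type*} [NormedAddCommGroup F] [NormedSpace ℝ F]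
    {f : ℝ → F} (hf : ContDiffOn ℝ ∞ f I) {σ : ℝ → ℝ}
    (hσ : ∀ᶠ w in 𝓝 (0 : ℝ), σ w ∈ I ∧ HasDerivAt σ (conformalDensity x (σ w))⁻¹ w) (k : ℕ) :
    ∀ᶠ w in 𝓝 (0 : ℝ), HasDerivAt (fun w => densityDeriv (conformalDensity x) f k (σ w))
      (densityDeriv (conformalDensity x) f (k + 1) (σ w)) w := by
  filter_upwards [hσ] with w hw
  have := (h.hasDerivAt_densityDeriv hf k hw.1).scomp w hw.2
  rwa [smul_smul, inv_mul_cancel₀ (h.conformalDensity_pos hw.1).ne', one_smul] at this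

end IsVertexFree

end ConformalLength

/-! ### Non-collinearity of nearby points -/

section AffineIndependence

theorem cross_smul_smul_add (a b c : ℝ) (u v : E3) :
    cross (a • u) (b • v + c • u) = (a * b) • cross u v := by
  ext i
  fin_cases i <;> simp [cross_apply_zero, cross_apply_one, cross_apply_two] <;> ring

theorem continuous_cross : Continuous fun p : E3 × E3 => cross p.1 p.2 := by
  have hc : ∀ i : Fin 3, Continuous fun p : E3 × E3 => p.1 i := fun i => by fun_prop
  have hd : ∀ i : Fin 3, Continuous fun p : E3 × E3 => p.2 i := fun i => by fun_prop
  refine (PiLp.continuous_toLp 2 _).comp (continuous_pi fun i => ?_)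
  fin_cases i <;> simp only [cross_apply] <;> simp <;> fun_prop

theorem affineIndependent_of_cross_ne_zero {p q r : E3} (a b c : ℝ)
    (h : cross (a • (q - p)) (b • (r - p) + c • (q - p)) ≠ 0) :
    AffineIndependent ℝ ![p, q, r] := by
  rw [affineIndependent_iff_not_collinear_set]
  intro hc
  obtain ⟨v, hv⟩ := (collinear_iff_of_mem (k := ℝ) (p₀ := p) (by simp)).1 hc
  obtain ⟨α, hα⟩ := hv q (by simp)
  obtain ⟨β, hβ⟩ := hv r (by simp)
  apply h
  rw [cross_smul_smul_add, hα, hβ]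
  simp only [vadd_eq_add, add_sub_cancel_right]
  ext i
  fin_cases i <;> simp [cross_apply_zero, cross_apply_one, cross_apply_two] <;> ring_nf <;> simp

/-- Three points of a curve with independent first and second derivatives, at parameters
proportional to a small `w`, are affinely independent. -/
theorem eventually_affineIndependent (g : ℕ → ℝ → E3)
    (hg : ∀ k, ∀ᶠ w in 𝓝 (0 : ℝ), HasDerivAt (g k) (g (k + 1) w) w)
    (hne : cross (g 1 0) (g 2 0) ≠ 0) {a b c : ℝ} (hab : a ≠ b) (hac : a ≠ c) (hbc : b ≠ c) :
    ∀ᶠ w in 𝓝[≠] (0 : ℝ), AffineIndependent ℝ ![g 0 (a * w), g 0 (b * w), g 0 (c * w)] := by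
  have hab' : b - a ≠ 0 := sub_ne_zero.2 hab.symm
  have hac' : c - a ≠ 0 := sub_ne_zero.2 hac.symm
  have hbc' : c - b ≠ 0 := sub_ne_zero.2 hbc.symm
  have hE := hasExpansion_of_hasDerivAt g hg 3
  have hB := (hE.comp_mul b).sub (hE.comp_mul a)
  have hC := (hE.comp_mul c).sub (hE.comp_mul a)
  -- `hU` and `hV` are the limits of the first and second divided differences at `a * w`, `b * w`,
  -- `c * w`, namely g'(0) and g''(0)/2. Their cross product has a nonzero limit.
  have hU := ((hB.const_smul (b - a)⁻¹).inv_pow_smul (m := 1) (n := 2) fun k hk => by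
    interval_cases k; simp).tendsto nhdsWithin_le_nhds
  have hV := (((hC.const_smul ((c - a) * (c - b))⁻¹).sub
    (hB.const_smul ((b - a) * (c - b))⁻¹)).inv_pow_smul (m := 2) (n := 1) fun k hk => by
      interval_cases k
      · simp
      · simp only [Nat.factorial, ← smul_assoc, ← sub_smul]
        simp only [smul_eq_mul, pow_one]
        convert zero_smul ℝ (g 1 0) using 2
        field_simp
        ring).tendsto nhdsWithin_le_nhds
  have e₁ : (b - a)⁻¹ • (b ^ (1 + 0) • (((1 + 0).factorial : ℝ)⁻¹) • g (1 + 0) 0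
      - a ^ (1 + 0) • (((1 + 0).factorial : ℝ)⁻¹) • g (1 + 0) 0) = (1 : ℝ) • g 1 0 := by
    norm_num
    match_scalars
    field_simp
  have e₂ : (((c - a) * (c - b))⁻¹ • (c ^ (2 + 0) • (((2 + 0).factorial : ℝ)⁻¹) • g (2 + 0) 0
      - a ^ (2 + 0) • (((2 + 0).factorial : ℝ)⁻¹) • g (2 + 0) 0)
      - ((b - a) * (c - b))⁻¹ • (b ^ (2 + 0) • (((2 + 0).factorial : ℝ)⁻¹) • g (2 + 0) 0
      - a ^ (2 + 0) • (((2 + 0).factorial : ℝ)⁻¹) • g (2 + 0) 0))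
        = (1 / 2 : ℝ) • g 2 0 + (0 : ℝ) • g 1 0 := by
    simp only [Nat.add_zero, Nat.factorial]
    norm_num
    match_scalars
    field_simp
    ring
  rw [e₁] at hU
  rw [e₂] at hV
  have hcr := (continuous_cross.tendsto _).comp (hU.prodMk_nhds hV)
  have hlim : cross ((1 : ℝ) • g 1 0) ((1 / 2 : ℝ) • g 2 0 + (0 : ℝ) • g 1 0) ≠ 0 := by
    rw [cross_smul_smul_add]
    simpa using hne
  filter_upwards [hcr.eventually_ne hlim] with w hw
  refine affineIndependent_of_cross_ne_zero ((w ^ 1)⁻¹ * (b - a)⁻¹)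
    ((w ^ 2)⁻¹ * ((c - a) * (c - b))⁻¹) (-((w ^ 2)⁻¹ * ((b - a) * (c - b))⁻¹)) ?_
  have e : ∀ (α β γ : ℝ) (u v : E3),
      (α * β) • v + (-(α * γ)) • u = α • (β • v - γ • u) := fun α β γ u v => by module
  rw [e, mul_smul]
  exact hw

end AffineIndependence

/-! ### Regularity in conformal length and the main theorem -/

section Main

variable {I : Set ℝ} {x : ℝ → E3}

/-- The two derivatives are φ⁻¹ t and φ⁻²(κ n - θ t), with cross product φ⁻³ κ b. -/
theorem IsVertexFree.cross_densityDeriv_ne_zero (h : IsVertexFree I x) {s : ℝ} (hs : s ∈ I) :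
    cross (densityDeriv (conformalDensity x) x 1 s) (densityDeriv (conformalDensity x) x 2 s)
      ≠ 0 := by
  have h1 : ∀ s ∈ I, densityDeriv (conformalDensity x) x 1 s
      = (conformalDensity x s)⁻¹ • tangent x s := fun s _ => rfl
  have h2 := h.densityDeriv_succ_eq hs h1
    ((h.hasDerivAt_inv_conformalDensity hs).fun_smul (h.hasDerivAt_tangent hs))
  have hφ := (h.conformalDensity_pos hs).ne'
  have hκ := (h.curvature_pos s hs).ne'
  have hb : binormal x s ≠ 0 := fun h0 => by
    have := h.inner_binormal_binormal hs
    simp [h0] at this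
  rw [h1 s hs, h2, smul_add, smul_smul, smul_smul, smul_smul, cross_smul_smul_add]
  exact smul_ne_zero (by positivity) hb

end Main

end ConformalCurve

theorem mainTheorem1 (I : Set ℝ) (hIo : IsOpen I) (hIc : I.OrdConnected)
    (x : ℝ → E3) (hx : ContDiffOn ℝ ∞ x I) (hunit : ∀ s ∈ I, ‖deriv x s‖ = 1)
    (hκ : ∀ s ∈ I, 0 < curvature x s)
    (hν : ∀ s ∈ I, 0 < nu (curvature x) (torsion x) s)
    (s₀ : ℝ) (hs₀ : s₀ ∈ I) :
    -- the arc length parameter is locally a function of the conformal length from `s₀`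
    (∃ σ : ℝ → ℝ, IsConformalLengthInverse (curvature x) (torsion x) I s₀ σ) ∧
    (∀ σ : ℝ → ℝ, IsConformalLengthInverse (curvature x) (torsion x) I s₀ σ →
      σ 0 = s₀ ∧
      -- the points `x₁, …, x₅` are in such a position that consecutive triples fix circles
      (∀ᶠ w in 𝓝[≠] (0 : ℝ),
        AffineIndependent ℝ ![x (σ (-2 * w)), x (σ (-w)), x (σ 0)] ∧
        AffineIndependent ℝ ![x (σ (-w)), x (σ 0), x (σ w)] ∧
        AffineIndependent ℝ ![x (σ 0), x (σ w), x (σ (2 * w))]) ∧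
      (fun w : ℝ =>
          Real.cos (cuspAngle (x (σ (-2 * w))) (x (σ (-w))) (x (σ 0)) (x (σ w)))
            - (1 - w ^ 4 / 8 + sixthOrderCoeff (curvature x) (torsion x) s₀ * w ^ 6))
        =O[𝓝[≠] (0 : ℝ)] (fun w : ℝ => w ^ 7)) ∧
    sixthOrderCoeff (curvature x) (torsion x) s₀
      = (conformalCurvature (curvature x) (torsion x) s₀
          + 3 / 4 * (conformalTorsion (curvature x) (torsion x) s₀) ^ 2) / 24 := by
  have h : IsVertexFree I x := ⟨hIo, hx, hunit, hκ, hν⟩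
  refine ⟨?_, fun σ hσ => ?_, h.sixthOrderCoeff_eq hs₀⟩
  · obtain ⟨ρ, -, hρ⟩ := h.exists_localInverse_conformalLength hIc hs₀
    exact ⟨ρ, hρ.mono fun w hw => ⟨hw.1, hw.2.1⟩⟩
  obtain ⟨hσ0, hσd⟩ := h.hasDerivAt_of_isConformalLengthInverse hIc hs₀ hσ
  have hA : ∀ᶠ w in 𝓝[≠] (0 : ℝ),
      AffineIndependent ℝ ![x (σ (-2 * w)), x (σ (-w)), x (σ 0)] ∧
      AffineIndependent ℝ ![x (σ (-w)), x (σ 0), x (σ w)] ∧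
      AffineIndependent ℝ ![x (σ 0), x (σ w), x (σ (2 * w))] := by
    have key := fun (a b c : ℝ) hab hac hbc => eventually_affineIndependent
      (fun k w => densityDeriv (conformalDensity x) x k (σ w))
      (h.eventually_hasDerivAt_densityDeriv hx hσd)
      (by rw [hσ0]; exact h.cross_densityDeriv_ne_zero hs₀) (a := a) (b := b) (c := c) hab hac hbc
    filter_upwards [key (-2) (-1) 0 (by norm_num) (by norm_num) (by norm_num),
      key (-1) 0 1 (by norm_num) (by norm_num) (by norm_num),
      key 0 1 2 (by norm_num) (by norm_num) (by norm_num)] with w h1 h2 h3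
    simp only [neg_one_mul, zero_mul, one_mul] at h1 h2 h3
    exact ⟨h1, h2, h3⟩
  refine ⟨hσ0, hA, ?_⟩
  -- The weighted squared distances of the curve are -2 times the Lorentz products of its conformal
  -- lift.
  have key := h.isGramChain.isBigO_cos hs₀ lorentz (fun k w => conformalLift x k (σ w))
    (h.eventually_hasDerivAt_densityDeriv h.contDiffOn_smul_lightLift hσd)
    (fun k l => by rw [hσ0]; rfl) (h.conformalGram_four_four hs₀)
    (fun i j w => (conformalDensity x (σ (i * w)) * conformalDensity x (σ (j * w)))
      * ‖x (σ (i * w)) - x (σ (j * w))‖ ^ 2)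
    (fun i j w => by
      rw [← lorentz_lightLift]
      simp only [conformalLift, densityDeriv, map_smul, smul_apply, smul_eq_mul]
      ring)
  have hP : (-(conformalGramDeriv x 0 s₀) / 2
      + 3 / 4 * conformalTorsion (curvature x) (torsion x) s₀ ^ 2) / 24
      = sixthOrderCoeff (curvature x) (torsion x) s₀ := by
    rw [h.conformalGramDeriv_zero_eq hs₀, h.sixthOrderCoeff_eq hs₀]
    ring
  rw [hP] at key
  have hpos : ∀ i : ℝ, ∀ᶠ w in 𝓝[≠] (0 : ℝ), 0 < conformalDensity x (σ (i * w)) := by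
    intro i
    have ht : Filter.Tendsto (fun w : ℝ => i * w) (𝓝[≠] 0) (𝓝 0) :=
      ((continuous_const_mul i).tendsto' 0 0 (mul_zero i)).mono_left nhdsWithin_le_nhds
    exact (ht.eventually hσd).mono fun w hw => h.conformalDensity_pos hw.1
  refine key.congr' ?_ Filter.EventuallyEq.rfl
  filter_upwards [hA, hpos (-2), hpos (-1), hpos 0, hpos 1] with w hw p1 p2 p3 p4
  rw [cos_cuspAngle hw.1 hw.2.1]
  congr 1
  simp only [neg_one_mul, zero_mul, one_mul] at p2 p3 p4 ⊢
  generalize conformalDensity x (σ (-2 * w)) = l₁ at *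
  generalize conformalDensity x (σ (-w)) = l₂ at *
  generalize conformalDensity x (σ 0) = l₃ at *
  generalize conformalDensity x (σ w) = l₄ at *
  -- Every pairing of the four points carries the same weight l₁ l₂ l₃ l₄, which cancels against the
  -- root of its square.
  have hl : 0 < l₁ * l₂ * l₃ * l₄ := by positivity
  have e : ∀ a b c d : ℝ, l₁ * l₂ * a * (l₃ * l₄ * b) * (l₁ * l₃ * c * (l₂ * l₄ * d))
      = (l₁ * l₂ * l₃ * l₄) ^ 2 * (a * b * (c * d)) := fun a b c d => by ring
  rw [e, Real.sqrt_mul (by positivity), Real.sqrt_sq hl.le,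
    mul_left_comm 2, ← mul_div_mul_left _ (2 * √_) hl.ne']
  congr 1
  ring
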